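/- Let $n\ge 1$ and $0\le k<n$ be integers. For $x\in\mathbb{R}^n$ and $r>0$ let $S_k^{j}(x,r)$, $j=1,\dots,N$, $N=2^{n-k}\binom nk$, be the $k$-dimensional faces of the cube with axis-parallel sides, centre $x$ and side length $2r$, and let $S_{k,\delta}^{j}(x,r)$ be the $\delta$-neighbourhood of $S_k^{j}(x,r)$. For $0<\delta<1$ and $f\in L^1_{\rm loc}(\mathbb{R}^n)$, the $k$-skeleton maximal operator with width $\delta$ is $$M^k_\delta f(x)=\sup_{1\le r\le 2}\ \min_{1\le j\le N}\ \frac{1}{|S_{k,\delta}^{j}(x,r)|}\int_{S_{k,\delta}^{j}(x,r)}|f(y)|\,dy ,$$ and $\|M^k_\delta\|_{L^p\to L^q}=\sup_{0\ne f\in L^p(\mathbb{R}^n)}\|M^k_\delta f\|_{L^q(\mathbb{R}^n)}/\|f\|_{L^p(\mathbb{R}^n)}$. Put $$q^*=\frac{2n^2}{(n-k)(2n-1)} ,$$ and let $1<p\le q<\infty$. (i) If $q\le q^*p$, then there is a constant $C=C(p,q,k,n)>0$ and, for every $\varepsilon>0$, a constant $C'=C'(p,q,k,n,\varepsilon)>0$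 such that for all $\delta\in(0,1)$ $$C'\,\delta^{\frac{k-n}{2np}+\varepsilon}\le\|M^k_\delta\|_{L^p\to L^q}\le C\,\delta^{\frac{k-n}{2np}} .$$ (ii) If $q>q^*p$, then there are constants $c,c'>0$ depending only on $p,q,k,n$ such that for all $\delta\in(0,1)$ $$c'\,\delta^{\frac nq-\frac{n-k}{p}}\le\|M^k_\delta\|_{L^p\to L^q}\le c\,\delta^{\frac nq-\frac{n-k}{p}} .$$ -/

import Mathlib

open MeasureTheory Set
open scoped ENNReal

noncomputable section

namespace SkeletonMax

/-- The labels of the `k`-faces of an axis-parallel cube in `ℝⁿ`: a sign pattern `σ` with exactly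
`k` zeros. The zeros are the free coordinates of the face and the signs `±1` say on which side of
the centre each of the other `n - k` coordinates is fixed. There are `2 ^ (n - k) * n.choose k`
of them. -/
def FaceIndex (n k : ℕ) : Type :=
  {σ : Fin n → SignType // (Finset.univ.filter fun i => σ i = 0).card = k}

/-- The (closed) `k`-face with label `j` of the axis-parallel cube with centre `x` and side
length `2 * r`. -/
def face {n k : ℕ} (j : FaceIndex n k) (x : EuclideanSpace ℝ (Fin n)) (r : ℝ) :
    Set (EuclideanSpace ℝ (Fin n)) :=
  {y | ∀ i, (j.1 i = 0 → |y i - x i| ≤ r) ∧ (j.1 i ≠ 0 → y i = x i + (j.1 i : ℝ) * r)}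

/-- The `k`-skeleton maximal operator with width `δ`: the supremum over `1 ≤ r ≤ 2` of the minimum
over the `k`-faces of the cube with centre `x` and side length `2 * r` of the average of `|f|` over
the `δ`-neighbourhood of the face. -/
def skeletonMaximal {n : ℕ} (k : ℕ) (δ : ℝ) (f : EuclideanSpace ℝ (Fin n) → ℝ)
    (x : EuclideanSpace ℝ (Fin n)) : ℝ≥0∞ :=
  ⨆ r ∈ Icc (1 : ℝ) 2, ⨅ j : FaceIndex n k,
    ⨍⁻ y in Metric.thickening δ (face j x r), ‖f y‖ₑ ∂volume

/-- The norm of the `k`-skeleton maximal operator from `L^p(ℝⁿ)` to `L^q(ℝⁿ)`: the supremum of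
`‖M f‖_q / ‖f‖_p` over all nonzero `f ∈ L^p`. -/
def skeletonMaximalNorm (n k : ℕ) (δ p q : ℝ) : ℝ≥0∞ :=
  ⨆ f ∈ {f : EuclideanSpace ℝ (Fin n) → ℝ |
      MemLp f (ENNReal.ofReal p) volume ∧ ¬ f =ᵐ[volume] 0},
    eLpNorm (skeletonMaximal k δ f) (ENNReal.ofReal q) volume /
      eLpNorm f (ENNReal.ofReal p) volume

/-- The exponent `q* = 2n² / ((n - k)(2n - 1))`. -/
def qStar (n k : ℕ) : ℝ := 2 * (n : ℝ) ^ 2 / (((n : ℝ) - k) * (2 * n - 1))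

end SkeletonMax

end

/-! Upper bounds. Suppose that each centre in some set has a cube all of whose thickened `k`-faces
carry mass at least `a` of a measure. Round centres and radii to multiples of `δ`. A thickened face
is then located, up to bounded error, by the `n - k` fixed coordinates of a vertex `x + σ s(x)`. By
`exists_card_rpow_le_card_image`, for some signs and some fixed coordinates, `N` rounded centres
give at least `N^(1/q*)` locations. Boxes at different locations have bounded overlap, so the total
mass is at least a constant times `N^(1/q*) a`. Summing over unit cubes gives a truncated weak type
`(1, s)` bound with `s = q / p` (`measure_rpow_mul_le`), and a dyadic decomposition turns it into
`L^p → L^(ps)` (`lintegral_rpow_le_of_weak_type`). The two regimes come from comparing `N^(1/s)`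
with `N^(1/q*)`: for `s ≤ q*` through `N ≤ (3/δ)^n`, for `s ≥ q*` through `N ≥ 1`.

The counting is an entropy argument. Let `x` be uniform on `A`, and let `d_i` be `n` independent
main diagonals. The vertices `x ± s(x) d_i` together determine `x`, and each alone determines the `n
- 1` dual forms vanishing on `d_i`. Submodularity bounds `H(x)` plus the entropy of these forms by
the sum of the two vertex entropies. Summing over `i`, with Han's inequality for the forms, some
vertex has entropy at least `(2n-1)/(2n) * log |A|`. By Han's inequality again, some `n - k` of its
coordinates retain the fraction `(n-k)/n`. The product of the fractions is `1/q*`.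

Lower bounds use indicator functions. In (ii) the set is a neighbourhood of one skeleton, and the
centres fill a `δ`-ball. In (i) the centres fill a unit cube: a set `D` of reals of measure
`O(δ^(1/(2n)))` contains, for a suitable `r`, the `δ`-neighbourhoods of all `2n` numbers `±x_j + r`
(`exists_thin_set`). This loses no `ε`. -/

noncomputable section

namespace SkeletonMax

/-! ### Entropy of functions on a finite set and its submodularity. -/

section Entropy

variable {α β γ κ ι : Type*}

open Classical in
/-- The number of points of `A` in the fibre of `f` through `x`. -/
def fiberCard (A : Finset α) (f : α → β) (x : α) : ℕ := (A.filter fun y => f y = f x).card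

/-- `A.card` times the Shannon entropy of `f` applied to a uniformly distributed point of `A`. -/
def fiberEntropy (A : Finset α) (f : α → β) : ℝ :=
  ∑ x ∈ A, Real.log (A.card / fiberCard A f x)

theorem fiberCard_pos {A : Finset α} (f : α → β) {x : α} (hx : x ∈ A) : 0 < fiberCard A f x := by
  classical
  exact Finset.card_pos.2 ⟨x, by simp [hx]⟩

theorem fiberCard_congr (A : Finset α) {f : α → β} {x y : α} (h : f x = f y) :
    fiberCard A f x = fiberCard A f y := by
  unfold fiberCard
  congr 1
  ext z
  simp [h]

theorem fiberCard_le_of_refines {A : Finset α} {f : α → β} {g : α → γ} {x : α}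
    (h : ∀ y ∈ A, f y = f x → g y = g x) : fiberCard A f x ≤ fiberCard A g x := by
  classical
  refine Finset.card_le_card fun y hy => ?_
  simp only [Finset.mem_filter] at hy ⊢
  exact ⟨hy.1, h y hy.1 hy.2⟩

/-- The numerator counts pairs `(y, y')` with `u y = u x` and `v y' = v x`. For a fixed pair, the
admissible `x` form at most one `(u, v)`-fibre and contribute at most `1 / fiberCard A w y`. Only
`y'` in the `w`-fibre of `y` occur, so each `y` contributes at most `1`. -/
theorem sum_fiberCard_mul_div_le (A : Finset α) (u : α → β) (v : α → γ) (w : α → κ)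
    (huw : ∀ x ∈ A, ∀ y ∈ A, u x = u y → w x = w y)
    (hvw : ∀ x ∈ A, ∀ y ∈ A, v x = v y → w x = w y) :
    ∑ x ∈ A, (fiberCard A u x * fiberCard A v x : ℝ) /
      (fiberCard A (fun x => (u x, v x)) x * fiberCard A w x) ≤ A.card := by
  classical
  set p : α → β × γ := fun x => (u x, v x) with hp
  have h1 : ∀ x ∈ A, (fiberCard A u x * fiberCard A v x : ℝ) /
      (fiberCard A p x * fiberCard A w x) = ∑ y ∈ A, ∑ y' ∈ A,
        if u y = u x ∧ v y' = v x then 1 / (fiberCard A p x * fiberCard A w x : ℝ) else 0 := by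
    intro x _
    simp_rw [← Finset.sum_product', ← Finset.sum_filter, Finset.sum_const]
    rw [Finset.filter_product (fun y => u y = u x) (fun y => v y = v x), Finset.card_product, nsmul_eq_mul]
    simp only [fiberCard]
    push_cast
    ring
  rw [Finset.sum_congr rfl h1, Finset.sum_comm]
  have h2 : ∀ y ∈ A, ∑ x ∈ A, ∑ y' ∈ A,
      (if u y = u x ∧ v y' = v x then 1 / (fiberCard A p x * fiberCard A w x : ℝ) else 0) ≤ 1 := by
    intro y hy
    rw [Finset.sum_comm]
    have h3 : ∀ y' ∈ A, ∑ x ∈ A,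
        (if u y = u x ∧ v y' = v x then 1 / (fiberCard A p x * fiberCard A w x : ℝ) else 0) ≤
        if w y' = w y then 1 / (fiberCard A w y : ℝ) else 0 := by
      intro y' hy'
      by_cases hex : ∃ x ∈ A, u y = u x ∧ v y' = v x
      · obtain ⟨x₀, hx₀, h₁, h₂⟩ := hex
        have hwy : w y = w x₀ := huw _ hy _ hx₀ h₁
        have hwy' : w y' = w x₀ := hvw _ hy' _ hx₀ h₂
        rw [if_pos (hwy'.trans hwy.symm), ← Finset.sum_filter]
        have h4 : ∀ x ∈ A.filter (fun x => u y = u x ∧ v y' = v x),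
            1 / (fiberCard A p x * fiberCard A w x : ℝ) =
              1 / (fiberCard A p x₀ * fiberCard A w y) := by
          intro x hx
          simp only [Finset.mem_filter] at hx
          rw [fiberCard_congr A (f := p) (x := x) (y := x₀)
              (by simp [hp, ← hx.2.1, ← hx.2.2, h₁, h₂]),
            fiberCard_congr A (huw _ hx.1 _ hy hx.2.1.symm)]
        rw [Finset.sum_congr rfl h4, Finset.sum_const, nsmul_eq_mul]
        have h5 : (A.filter (fun x => u y = u x ∧ v y' = v x)).card = fiberCard A p x₀ := by
          unfold fiberCard
          congr 1
          ext x
          simp only [Finset.mem_filter, hp, Prod.mk.injEq, h₁, h₂]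
          tauto
        rw [h5]
        have h6 : (0 : ℝ) < fiberCard A p x₀ := by exact_mod_cast fiberCard_pos p hx₀
        have h7 : (0 : ℝ) < fiberCard A w y := by exact_mod_cast fiberCard_pos w hy
        apply le_of_eq
        field_simp
      · rw [Finset.sum_eq_zero]
        · split_ifs <;> positivity
        · intro x hx
          rw [if_neg]
          exact fun h => hex ⟨x, hx, h⟩
    refine (Finset.sum_le_sum h3).trans ?_
    rw [← Finset.sum_filter, Finset.sum_const, nsmul_eq_mul]
    have h7 : (0 : ℝ) < fiberCard A w y := by exact_mod_cast fiberCard_pos w hy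
    change (fiberCard A w y : ℝ) * _ ≤ 1
    apply le_of_eq
    field_simp
  simpa using Finset.sum_le_sum h2

/-- This is nonnegativity of conditional mutual information given `w`, obtained by summing `log t ≤
t - 1`. Allowing any `z` determined by `(u, v)` avoids naming the joint variable in the
applications. -/
theorem fiberEntropy_submodular (A : Finset α) (u : α → β) (v : α → γ) (w : α → κ) (z : α → ι)
    (huw : ∀ x ∈ A, ∀ y ∈ A, u x = u y → w x = w y)
    (hvw : ∀ x ∈ A, ∀ y ∈ A, v x = v y → w x = w y)
    (hz : ∀ x ∈ A, ∀ y ∈ A, u x = u y → v x = v y → z x = z y) :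
    fiberEntropy A z + fiberEntropy A w ≤ fiberEntropy A u + fiberEntropy A v := by
  have key : ∀ x ∈ A, Real.log (A.card / fiberCard A z x) + Real.log (A.card / fiberCard A w x) -
      Real.log (A.card / fiberCard A u x) - Real.log (A.card / fiberCard A v x) ≤
      (fiberCard A u x * fiberCard A v x : ℝ) /
      (fiberCard A (fun x => (u x, v x)) x * fiberCard A w x) - 1 := by
    intro x hx
    have hN : (0 : ℝ) < A.card := by exact_mod_cast Finset.card_pos.2 ⟨x, hx⟩
    have hu : (0 : ℝ) < fiberCard A u x := by exact_mod_cast fiberCard_pos u hx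
    have hv : (0 : ℝ) < fiberCard A v x := by exact_mod_cast fiberCard_pos v hx
    have hw : (0 : ℝ) < fiberCard A w x := by exact_mod_cast fiberCard_pos w hx
    have hzz : (0 : ℝ) < fiberCard A z x := by exact_mod_cast fiberCard_pos z hx
    have hp : (0 : ℝ) < fiberCard A (fun x => (u x, v x)) x := by
      exact_mod_cast fiberCard_pos _ hx
    have hle : (fiberCard A (fun x => (u x, v x)) x : ℝ) ≤ fiberCard A z x := by
      exact_mod_cast fiberCard_le_of_refines fun y hy h => by
        simp only [Prod.mk.injEq] at h
        exact hz _ hy _ hx h.1 h.2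
    have h1 : Real.log (A.card / fiberCard A z x) + Real.log (A.card / fiberCard A w x) -
        Real.log (A.card / fiberCard A u x) - Real.log (A.card / fiberCard A v x) =
        Real.log ((fiberCard A u x * fiberCard A v x : ℝ) / (fiberCard A z x * fiberCard A w x)) := by
      rw [Real.log_div hN.ne' hu.ne', Real.log_div hN.ne' hv.ne', Real.log_div hN.ne' hw.ne',
        Real.log_div hN.ne' hzz.ne', Real.log_div (by positivity) (by positivity),
        Real.log_mul hu.ne' hv.ne', Real.log_mul hzz.ne' hw.ne']
      ring
    rw [h1]
    refine (Real.log_le_sub_one_of_pos (by positivity)).trans ?_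
    gcongr
  have h := Finset.sum_le_sum key
  simp only [Finset.sum_sub_distrib, Finset.sum_add_distrib] at h
  have h' := sum_fiberCard_mul_div_le A u v w huw hvw
  simp only [Finset.sum_const, nsmul_eq_mul, mul_one] at h
  unfold fiberEntropy
  linarith

theorem fiberEntropy_of_injOn {A : Finset α} {f : α → β}
    (hf : ∀ x ∈ A, ∀ y ∈ A, f x = f y → x = y) :
    fiberEntropy A f = A.card * Real.log A.card := by
  classical
  have : ∀ x ∈ A, Real.log (A.card / fiberCard A f x) = Real.log A.card := by
    intro x hx
    have : fiberCard A f x = 1 := by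
      unfold fiberCard
      rw [Finset.card_eq_one]
      refine ⟨x, ?_⟩
      ext y
      simp only [Finset.mem_filter, Finset.mem_singleton]
      exact ⟨fun h => hf _ h.1 _ hx h.2, fun h => by subst h; exact ⟨hx, rfl⟩⟩
    simp [this]
  rw [fiberEntropy, Finset.sum_congr rfl this]
  simp

theorem fiberEntropy_of_const {A : Finset α} {f : α → β}
    (hf : ∀ x ∈ A, ∀ y ∈ A, f x = f y) : fiberEntropy A f = 0 := by
  classical
  refine Finset.sum_eq_zero fun x hx => ?_
  have : fiberCard A f x = A.card := by
    unfold fiberCard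
    rw [Finset.filter_true_of_mem fun y hy => hf y hy x hx]
  rw [this, div_self, Real.log_one]
  exact_mod_cast (Finset.card_pos.2 ⟨x, hx⟩).ne'

/-- Again `log t ≤ t - 1`, since the reciprocals of the fibre sizes sum to the number of values of
`f`. -/
theorem fiberEntropy_le [DecidableEq β] (A : Finset α) (f : α → β) :
    fiberEntropy A f ≤ A.card * Real.log (A.image f).card := by
  classical
  have key : ∀ x ∈ A, Real.log (A.card / fiberCard A f x) - Real.log (A.image f).card ≤
      A.card / (A.image f).card * (1 / fiberCard A f x : ℝ) - 1 := by
    intro x hx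
    have hN : (0 : ℝ) < A.card := by exact_mod_cast Finset.card_pos.2 ⟨x, hx⟩
    have hI : (0 : ℝ) < (A.image f).card := by
      exact_mod_cast Finset.card_pos.2 ⟨f x, Finset.mem_image_of_mem f hx⟩
    have hu : (0 : ℝ) < fiberCard A f x := by exact_mod_cast fiberCard_pos f hx
    rw [← Real.log_div (by positivity) (by positivity)]
    refine (Real.log_le_sub_one_of_pos (by positivity)).trans (le_of_eq ?_)
    field_simp
  have h := Finset.sum_le_sum key
  simp only [Finset.sum_sub_distrib, Finset.sum_const, nsmul_eq_mul, mul_one,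
    ← Finset.mul_sum] at h
  have hs : ∑ x ∈ A, (1 / fiberCard A f x : ℝ) = (A.image f).card := by
    rw [Finset.card_eq_sum_ones, Nat.cast_sum,
      ← Finset.sum_fiberwise_of_maps_to (fun x hx => Finset.mem_image_of_mem f hx)]
    refine Finset.sum_congr rfl fun b hb => ?_
    obtain ⟨x, hx, rfl⟩ := Finset.mem_image.1 hb
    have : ∀ y ∈ A.filter (fun y => f y = f x), (1 / fiberCard A f y : ℝ) = 1 / fiberCard A f x := by
      intro y hy
      rw [fiberCard_congr A (Finset.mem_filter.1 hy).2]
    rw [Finset.sum_congr rfl this, Finset.sum_const, nsmul_eq_mul]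
    have hu : (0 : ℝ) < fiberCard A f x := by exact_mod_cast fiberCard_pos f hx
    have h8 : (Finset.card (A.filter fun y => f y = f x) : ℝ) = fiberCard A f x := by
      unfold fiberCard
      congr
    rw [h8]
    field_simp
    simp
  rw [hs] at h
  have hle : (A.card / (A.image f).card : ℝ) * (A.image f).card ≤ A.card :=
    (div_mul_eq_mul_div _ _ _).trans_le (div_le_of_le_mul₀ (by positivity) (by positivity) le_rfl)
  unfold fiberEntropy
  linarith

end Entropy

/-! ### Han's inequality for submodular set functions. -/

section Submodular

variable {ι : Type*} [DecidableEq ι]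

/-- Diminishing returns: the increment of `F` on adding `a` last, to `S.erase a`, is at most that on
adding it earlier, to a smaller set. The earlier increments telescope to `F T`. -/
theorem sum_sub_erase_le {F : Finset ι → ℝ} (h0 : F ∅ = 0)
    (hF : ∀ S T, F (S ∪ T) + F (S ∩ T) ≤ F S + F T) (S T : Finset ι) (hT : T ⊆ S) :
    ∑ i ∈ T, (F S - F (S.erase i)) ≤ F T := by
  induction T using Finset.induction_on with
  | empty => simp [h0]
  | insert a T ha ih =>
    rw [Finset.sum_insert ha]
    have haS : a ∈ S := hT (Finset.mem_insert_self a T)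
    have hTS : T ⊆ S := (Finset.subset_insert a T).trans hT
    have h := hF (S.erase a) (insert a T)
    have h1 : S.erase a ∪ insert a T = S := by
      ext i
      simp only [Finset.mem_union, Finset.mem_erase, Finset.mem_insert]
      constructor
      · rintro (h | rfl | h)
        exacts [h.2, haS, hTS h]
      · intro h
        by_cases hia : i = a <;> tauto
    have h2 : S.erase a ∩ insert a T = T := by
      ext i
      simp only [Finset.mem_inter, Finset.mem_erase, Finset.mem_insert]
      constructor
      · tauto
      · intro h
        exact ⟨⟨fun hi => ha (hi ▸ h), hTS h⟩, Or.inr h⟩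
    rw [h1, h2] at h
    linarith [ih hTS]

theorem exists_card_eq_le {F : Finset ι → ℝ} (h0 : F ∅ = 0)
    (hF : ∀ S T, F (S ∪ T) + F (S ∩ T) ≤ F S + F T) (S : Finset ι) (d : ℕ) :
    ∀ m, m + d = S.card → ∃ J ⊆ S, J.card = m ∧ m * F S ≤ S.card * F J := by
  induction d with
  | zero => exact fun m hm => ⟨S, subset_rfl, by omega, by simp [← hm]⟩
  | succ d ih =>
    intro m hm
    obtain ⟨J, hJS, hJ, hle⟩ := ih (m + 1) (by omega)
    have hsum := sum_sub_erase_le h0 hF J J subset_rfl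
    have hne : J.Nonempty := Finset.card_pos.1 (by omega)
    -- Otherwise each of the `m + 1` increments exceeds `F J / (m + 1)`, and their sum exceeds `F
    -- J`.
    obtain ⟨i, hi, hi'⟩ : ∃ i ∈ J, (m : ℝ) / (m + 1) * F J ≤ F (J.erase i) := by
      by_contra! hcon
      have h2 := Finset.sum_lt_sum_of_nonempty hne hcon
      simp only [Finset.sum_sub_distrib, Finset.sum_const, nsmul_eq_mul, hJ] at hsum h2
      push_cast at hsum h2
      have h3 : ((m : ℝ) + 1) * (m / (m + 1) * F J) = m * F J := by field_simp
      linarith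
    refine ⟨J.erase i, (Finset.erase_subset _ _).trans hJS, by
      rw [Finset.card_erase_of_mem hi, hJ]; rfl, ?_⟩
    calc (m : ℝ) * F S = m / (m + 1) * ((m + 1 : ℕ) * F S) := by push_cast; field_simp
      _ ≤ m / (m + 1) * (S.card * F J) := by gcongr
      _ = S.card * (m / (m + 1) * F J) := by ring
      _ ≤ _ := by gcongr

end Submodular

/-! ### Counting vertices of discrete cubes through their main diagonals. -/

section Diagonals

variable {n : ℕ}

/-- The direction of a main diagonal of the cube; for `i : Fin n` these are independent. -/
def diagSign (i j : Fin n) : ℤ := if j ≤ i then 1 else -1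

/-- Up to a factor, the basis of linear forms dual to the directions `diagSign`. -/
def diagForm (j : Fin n) (x : Fin n → ℤ) : ℤ :=
  if h : j.1 + 1 < n then x j - x ⟨j.1 + 1, h⟩ else x ⟨0, j.pos⟩ + x j

theorem diagForm_add_mul {i j : Fin n} (hij : j ≠ i) (x : Fin n → ℤ) (c : ℤ) :
    diagForm j (fun l => x l + diagSign i l * c) = diagForm j x := by
  have hne : j.1 ≠ i.1 := fun h => hij (Fin.ext h)
  have hi := i.2
  have hj := j.2
  unfold diagForm diagSign
  split_ifs with h
  all_goals simp only [Fin.le_def] at *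
  all_goals split_ifs
  all_goals omega

/-- The difference forms make `x - y` a constant vector. The last form says that its first and last
entries sum to zero, so the constant is zero. -/
theorem eq_of_diagForm_eq {x y : Fin n → ℤ} (h : ∀ j, diagForm j x = diagForm j y) : x = y := by
  rcases Nat.eq_zero_or_pos n with rfl | hn
  · exact Subsingleton.elim _ _
  have hstep : ∀ m (hm : m < n), x ⟨m, hm⟩ - y ⟨m, hm⟩ = x ⟨0, hn⟩ - y ⟨0, hn⟩ := by
    intro m
    induction m with
    | zero => exact fun _ => rfl
    | succ m ih =>
      intro hm
      have h1 := h ⟨m, by omega⟩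
      have h2 := ih (by omega)
      simp only [diagForm, hm, dif_pos] at h1
      omega
  have hlast := h ⟨n - 1, by omega⟩
  have h3 := hstep (n - 1) (by omega)
  rw [diagForm, diagForm, dif_neg (by simp; omega), dif_neg (by simp; omega)] at hlast
  funext j
  have h4 := hstep j.1 j.2
  simp only [Fin.eta] at h4
  omega

theorem exists_sign_fiberEntropy_le (hn : 0 < n) (A : Finset (Fin n → ℤ))
    (s : (Fin n → ℤ) → ℤ) :
    ∃ σ : Fin n → ℤ, (∀ j, σ j = 1 ∨ σ j = -1) ∧
      (2 * n - 1) * (A.card * Real.log A.card) ≤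
        2 * n * fiberEntropy A (fun x j => x j + σ j * s x) := by
  have hform : ∀ S : Finset (Fin n), ∀ x y : Fin n → ℤ,
      ((fun j : S => diagForm j.1 x) = fun j : S => diagForm j.1 y) ↔
        ∀ j ∈ S, diagForm j x = diagForm j y := by
    intro S x y
    simp [funext_iff]
  set F : Finset (Fin n) → ℝ := fun S => fiberEntropy A (fun x (j : S) => diagForm j.1 x) with hFdef
  have h0 : F ∅ = 0 := fiberEntropy_of_const fun x _ y _ => (hform _ _ _).2 (by simp)
  have hF : ∀ S T, F (S ∪ T) + F (S ∩ T) ≤ F S + F T := by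
    intro S T
    apply fiberEntropy_submodular
    · intro x _ y _ h
      rw [hform] at h ⊢
      exact fun j hj => h j (Finset.mem_inter.1 hj).1
    · intro x _ y _ h
      rw [hform] at h ⊢
      exact fun j hj => h j (Finset.mem_inter.1 hj).2
    · intro x _ y _ h h'
      rw [hform] at h h' ⊢
      exact fun j hj => (Finset.mem_union.1 hj).elim (h j) (h' j)
  have huniv : F Finset.univ = A.card * Real.log A.card :=
    fiberEntropy_of_injOn fun x _ y _ h =>
      eq_of_diagForm_eq fun j => (hform _ _ _).1 h j (Finset.mem_univ j)
  have hsum := sum_sub_erase_le h0 hF Finset.univ Finset.univ subset_rfl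
  -- The two opposite vertices add up to `2x`, hence determine `x`; each one determines the forms
  -- with index other than `i`, by `diagForm_add_mul`.
  have hpair : ∀ i : Fin n, A.card * Real.log A.card + F (Finset.univ.erase i) ≤
      fiberEntropy A (fun x j => x j + diagSign i j * s x) +
        fiberEntropy A (fun x j => x j + -diagSign i j * s x) := by
    intro i
    rw [← fiberEntropy_of_injOn (A := A) (f := id) fun x _ y _ h => h]
    have hinv : ∀ (c : (Fin n → ℤ) → ℤ) (x y : Fin n → ℤ),
        (fun j => x j + diagSign i j * c x) = (fun j => y j + diagSign i j * c y) →
        ∀ j ∈ Finset.univ.erase i, diagForm j x = diagForm j y := by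
      intro c x y h j hj
      have hji := Finset.ne_of_mem_erase hj
      rw [← diagForm_add_mul hji x (c x), h, diagForm_add_mul hji]
    apply fiberEntropy_submodular
    · intro x _ y _ h
      exact (hform _ _ _).2 (hinv s x y h)
    · intro x _ y _ h
      refine (hform _ _ _).2 (hinv (fun z => - s z) x y ?_)
      simpa only [neg_mul, mul_neg] using h
    · intro x _ y _ h h'
      funext j
      have h1 := congrFun h j
      have h2 := congrFun h' j
      simp only [id] at *
      linarith
  -- Averaging over the `2n` vertices: the pair inequalities sum to at least `n + (n - 1)` times the
  -- entropy of `x`, so not all vertices can lie below the fraction `(2n-1)/(2n)`.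
  by_contra! hcon
  have hc : ∀ i : Fin n, 2 * n * (A.card * Real.log A.card + F (Finset.univ.erase i)) <
      2 * ((2 * n - 1) * (A.card * Real.log A.card)) := by
    intro i
    have h1 := hcon (diagSign i) (fun j => by unfold diagSign; split_ifs <;> simp)
    have h2 := hcon (fun j => -diagSign i j) (fun j => by unfold diagSign; split_ifs <;> simp)
    have h3 : (2 * n : ℝ) * (A.card * Real.log A.card + F (Finset.univ.erase i)) ≤ _ :=
      mul_le_mul_of_nonneg_left (hpair i) (by positivity)
    linarith
  have hne : (Finset.univ : Finset (Fin n)).Nonempty := ⟨⟨0, hn⟩, Finset.mem_univ _⟩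
  have h4 := Finset.sum_lt_sum_of_nonempty hne fun i _ => hc i
  rw [← Finset.mul_sum, Finset.sum_add_distrib] at h4
  rw [Finset.sum_sub_distrib, huniv] at hsum
  simp only [Finset.sum_const, Finset.card_univ, Fintype.card_fin, nsmul_eq_mul] at h4 hsum
  have hn' : (0 : ℝ) < n := by exact_mod_cast hn
  have h5 : (2 * n : ℝ) * (n * (A.card * Real.log A.card) - A.card * Real.log A.card) ≤
      2 * n * ∑ i : Fin n, F (Finset.univ.erase i) :=
    mul_le_mul_of_nonneg_left (by linarith) (by positivity)
  linarith

/-- The discrete form of the skeleton estimate: a family of cubes with distinct centres has a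
vertex pattern and a coordinate projection along which many points are seen. -/
theorem exists_card_rpow_le_card_image (hn : 0 < n) (A : Finset (Fin n → ℤ))
    (s : (Fin n → ℤ) → ℤ) {m : ℕ} (hm : 0 < m) (hmn : m ≤ n) :
    ∃ σ : Fin n → ℤ, (∀ j, σ j = 1 ∨ σ j = -1) ∧ ∃ J : Finset (Fin n), J.card = m ∧
      (A.card : ℝ) ^ ((m * (2 * n - 1) : ℝ) / (2 * n ^ 2)) ≤
        (A.image fun x j => if j ∈ J then x j + σ j * s x else 0).card := by
  classical
  have hn' : (1 : ℝ) ≤ n := by exact_mod_cast hn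
  have hm' : (0 : ℝ) < m := by exact_mod_cast hm
  have hexp : 0 < (m * (2 * n - 1) : ℝ) / (2 * n ^ 2) := by
    have : (0 : ℝ) < 2 * n - 1 := by linarith
    positivity
  obtain ⟨σ, hσ, hH⟩ := exists_sign_fiberEntropy_le hn A s
  refine ⟨σ, hσ, ?_⟩
  set F : Finset (Fin n) → ℝ := fun J =>
    fiberEntropy A (fun x j => if j ∈ J then x j + σ j * s x else 0) with hFdef
  have hform : ∀ S : Finset (Fin n), ∀ x y : Fin n → ℤ,
      ((fun j => if j ∈ S then x j + σ j * s x else 0) =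
        fun j => if j ∈ S then y j + σ j * s y else 0) ↔
        ∀ j ∈ S, x j + σ j * s x = y j + σ j * s y := by
    intro S x y
    rw [funext_iff]
    refine forall_congr' fun j => ?_
    split_ifs with h <;> simp [h]
  have h0 : F ∅ = 0 := fiberEntropy_of_const fun x _ y _ => (hform _ _ _).2 (by simp)
  have hF : ∀ S T, F (S ∪ T) + F (S ∩ T) ≤ F S + F T := by
    intro S T
    apply fiberEntropy_submodular
    · intro x _ y _ h
      rw [hform] at h ⊢
      exact fun j hj => h j (Finset.mem_inter.1 hj).1
    · intro x _ y _ h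
      rw [hform] at h ⊢
      exact fun j hj => h j (Finset.mem_inter.1 hj).2
    · intro x _ y _ h h'
      rw [hform] at h h' ⊢
      exact fun j hj => (Finset.mem_union.1 hj).elim (h j) (h' j)
  obtain ⟨J, -, hJ, hle⟩ := exists_card_eq_le h0 hF Finset.univ (n - m) m
    (by simp; omega)
  refine ⟨J, hJ, ?_⟩
  have huniv : F Finset.univ = fiberEntropy A (fun x j => x j + σ j * s x) := by
    simp [hFdef]
  rw [huniv, Finset.card_univ, Fintype.card_fin] at hle
  rcases A.eq_empty_or_nonempty with rfl | hA
  · simp [Real.zero_rpow hexp.ne']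
  have hA' : (0 : ℝ) < A.card := by exact_mod_cast Finset.card_pos.2 hA
  set W := A.image fun x j => if j ∈ J then x j + σ j * s x else 0 with hW
  have hW' : (0 : ℝ) < W.card := by exact_mod_cast Finset.card_pos.2 (hA.image _)
  have hJle : F J ≤ A.card * Real.log W.card := fiberEntropy_le A _
  rw [← Real.log_le_log_iff (by positivity) hW', Real.log_rpow hA', div_mul_eq_mul_div,
    div_le_iff₀ (by positivity)]
  refine le_of_mul_le_mul_left ?_ hA'
  calc (A.card : ℝ) * (m * (2 * n - 1) * Real.log A.card)
      = m * ((2 * n - 1) * (A.card * Real.log A.card)) := by ring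
    _ ≤ m * (2 * n * fiberEntropy A (fun x j => x j + σ j * s x)) := by gcongr
    _ = 2 * n * (m * fiberEntropy A (fun x j => x j + σ j * s x)) := by ring
    _ ≤ 2 * n * (n * F J) := by gcongr
    _ ≤ 2 * n * (n * (A.card * Real.log W.card)) := by gcongr
    _ = _ := by ring

end Diagonals

/-! ### From truncated weak type bounds to strong type bounds. -/

section Interpolation

theorem tsum_rpow_le_tsum_rpow {ι : Type*} (a : ι → ℝ≥0∞) {θ : ℝ} (h0 : 0 < θ) (h1 : θ ≤ 1) :
    (∑' i, a i) ^ θ ≤ ∑' i, a i ^ θ := by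
  classical
  have hfin : ∀ s : Finset ι, (∑ i ∈ s, a i) ^ θ ≤ ∑ i ∈ s, a i ^ θ := by
    intro s
    induction s using Finset.induction_on with
    | empty => simp [ENNReal.zero_rpow_of_pos h0]
    | insert i s hi ih =>
      rw [Finset.sum_insert hi, Finset.sum_insert hi]
      exact (ENNReal.rpow_add_le_add_rpow _ _ h0.le h1).trans (by gcongr)
  rw [← ENNReal.le_rpow_inv_iff h0, ENNReal.tsum_eq_iSup_sum]
  refine iSup_le fun s => ?_
  rw [ENNReal.le_rpow_inv_iff h0]
  exact (hfin s).trans (ENNReal.sum_le_tsum s)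

theorem exists_two_rpow_lt_le {t : ℝ≥0∞} (h0 : t ≠ 0) (ht : t ≠ ∞) :
    ∃ L : ℤ, (2 : ℝ≥0∞) ^ (L : ℝ) < t ∧ t ≤ 2 ^ ((L : ℝ) + 1) := by
  obtain ⟨L, hL⟩ := ENNReal.exists_mem_Ioc_zpow h0 ht (y := 2) (by norm_num) (by norm_num)
  refine ⟨L, ?_, ?_⟩
  · rw [ENNReal.rpow_intCast]; exact hL.1
  · have := hL.2
    rw [← ENNReal.rpow_intCast] at this
    push_cast at this
    exact this

theorem rpow_le_tsum_dyadic (t : ℝ≥0∞) {q : ℝ} (hq : 0 < q) :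
    t ^ q ≤ ∑' l : ℤ, 2 ^ (((l : ℝ) + 1) * q) * {l : ℤ | (2 : ℝ≥0∞) ^ (l : ℝ) < t}.indicator 1 l := by
  rcases eq_or_ne t 0 with rfl | h0
  · simp [ENNReal.zero_rpow_of_pos hq]
  rcases eq_or_ne t ∞ with rfl | ht
  · rw [ENNReal.top_rpow_of_pos hq, top_le_iff, ← top_le_iff]
    have hinj : Function.Injective ((↑) : ℕ → ℤ) := Nat.cast_injective
    refine le_trans ?_ (ENNReal.tsum_comp_le_tsum_of_injective hinj _)
    have : ∀ j : ℕ, (1 : ℝ≥0∞) ≤ 2 ^ ((((j : ℤ) : ℝ) + 1) * q) *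
        {l : ℤ | (2 : ℝ≥0∞) ^ (l : ℝ) < ∞}.indicator 1 (j : ℤ) := by
      intro j
      rw [indicator_of_mem (by simp), Pi.one_apply, mul_one]
      exact ENNReal.one_le_rpow (by norm_num) (by positivity)
    refine le_trans ?_ (ENNReal.tsum_le_tsum this)
    rw [ENNReal.tsum_const_eq_top_of_ne_zero one_ne_zero]
  · obtain ⟨L, hL, hL'⟩ := exists_two_rpow_lt_le h0 ht
    refine le_trans ?_ (ENNReal.le_tsum L)
    rw [indicator_of_mem (by exact hL), Pi.one_apply, mul_one, ENNReal.rpow_mul]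
    gcongr

theorem tsum_dyadic_le_rpow {t : ℝ≥0∞} (ht : t ≠ ∞) {a : ℝ} (ha : 0 < a) :
    ∑' l : ℤ, 2 ^ ((l : ℝ) * a) * {l : ℤ | (2 : ℝ≥0∞) ^ (l : ℝ) < t}.indicator 1 l ≤
      (1 - 2 ^ (-a))⁻¹ * t ^ a := by
  rcases eq_or_ne t 0 with rfl | h0
  · simp
  obtain ⟨L, hL, hL'⟩ := exists_two_rpow_lt_le h0 ht
  have hinj : Function.Injective (fun j : ℕ => L - (j : ℤ)) := by
    intro i j h
    simpa using h
  rw [← hinj.tsum_eq]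
  · have hle : ∀ j : ℕ, (2 : ℝ≥0∞) ^ (((L - (j : ℤ) : ℤ) : ℝ) * a) *
        {l : ℤ | (2 : ℝ≥0∞) ^ (l : ℝ) < t}.indicator 1 (L - (j : ℤ)) ≤
        (2 ^ (-a)) ^ j * t ^ a := by
      intro j
      calc _ ≤ (2 : ℝ≥0∞) ^ (((L - (j : ℤ) : ℤ) : ℝ) * a) * 1 := by
            gcongr
            exact indicator_le_self' (fun _ _ => zero_le) _
        _ = (2 ^ (-a)) ^ j * (2 ^ (L : ℝ)) ^ a := by
            rw [← ENNReal.rpow_natCast, ← ENNReal.rpow_mul, ← ENNReal.rpow_mul,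
              ← ENNReal.rpow_add _ _ (by norm_num) (by norm_num), mul_one]
            congr 1
            push_cast
            ring
        _ ≤ _ := by gcongr
    refine (ENNReal.tsum_le_tsum hle).trans ?_
    rw [ENNReal.tsum_mul_right, ENNReal.tsum_geometric]
  · intro l hl
    have hmem : (2 : ℝ≥0∞) ^ (l : ℝ) < t := by
      by_contra hcon
      exact hl (by
        beta_reduce
        rw [indicator_of_notMem (show l ∉ {l : ℤ | (2 : ℝ≥0∞) ^ (l : ℝ) < t} from hcon), mul_zero])
    have h2 : (2 : ℝ≥0∞) ^ (l : ℝ) < 2 ^ ((L : ℝ) + 1) := hmem.trans_le hL'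
    have h3 : (l : ℝ) < L + 1 := by
      by_contra! hcon
      exact absurd h2 (not_lt.2 (ENNReal.rpow_le_rpow_of_exponent_le (by norm_num) hcon))
    have h4 : l < L + 1 := by exact_mod_cast h3
    refine ⟨(L - l).toNat, ?_⟩
    simp only
    omega

/-- Layer-cake decomposition into dyadic levels. Since `1 / s ≤ 1`, the outer power passes inside
the sum over levels. The truncation then leaves, at each `y`, a geometric series in `2 ^ (p - 1)`
stopped near `2 * g y`, which converges because `p > 1`. -/
theorem lintegral_rpow_le_of_weak_type {α β : Type*} [MeasurableSpace α] [MeasurableSpace β]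
    {μ : Measure α} {ν : Measure β} {T : α → ℝ≥0∞} {g : β → ℝ≥0∞} (hg : AEMeasurable g ν)
    (hgtop : ∀ y, g y ≠ ∞) {p s : ℝ} (hp : 1 < p) (hs : 1 ≤ s) {K : ℝ≥0∞}
    (hweak : ∀ l : ℤ, 2 ^ (l : ℝ) * μ {x | 2 ^ (l : ℝ) < T x} ^ (1 / s) ≤
      K * ∫⁻ y in {y | 2 ^ (l : ℝ) < 2 * g y}, g y ∂ν) :
    (∫⁻ x, T x ^ (p * s) ∂μ) ^ (1 / s) ≤
      2 ^ (2 * p) * (1 - 2 ^ (-(p - 1)))⁻¹ * K * ∫⁻ y, g y ^ p ∂ν := by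
  have hs0 : 0 < s := by linarith
  have hp0 : 0 < p := by linarith
  set E : ℤ → Set α := fun l => {x | 2 ^ (l : ℝ) < T x} with hE
  have h1 : ∫⁻ x, T x ^ (p * s) ∂μ ≤ ∑' l : ℤ, 2 ^ (((l : ℝ) + 1) * (p * s)) * μ (E l) := by
    -- `T` is not assumed measurable; measurable hulls of its superlevel sets allow sum and integral
    -- to be exchanged.
    calc ∫⁻ x, T x ^ (p * s) ∂μ ≤ ∫⁻ x, ∑' l : ℤ, 2 ^ (((l : ℝ) + 1) * (p * s)) *
          (toMeasurable μ (E l)).indicator 1 x ∂μ := by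
          refine lintegral_mono fun x => (rpow_le_tsum_dyadic (T x) (by positivity)).trans ?_
          refine ENNReal.tsum_le_tsum fun l => ?_
          gcongr
          by_cases hx : x ∈ E l
          · rw [indicator_of_mem (subset_toMeasurable μ _ hx), indicator_of_mem (by exact hx)]
            rfl
          · rw [indicator_of_notMem (by exact hx)]
            exact zero_le
      _ = ∑' l : ℤ, 2 ^ (((l : ℝ) + 1) * (p * s)) * μ (E l) := by
          have hm : ∀ l : ℤ, Measurable ((toMeasurable μ (E l)).indicator (1 : α → ℝ≥0∞)) :=
            fun l => measurable_one.indicator (measurableSet_toMeasurable μ _)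
          rw [lintegral_tsum fun l => ((hm l).const_mul _).aemeasurable]
          refine tsum_congr fun l => ?_
          rw [lintegral_const_mul _ (hm l), lintegral_indicator_one (measurableSet_toMeasurable μ _),
            measure_toMeasurable]
  have hset : ∀ l : ℤ, NullMeasurableSet {y | (2 : ℝ≥0∞) ^ (l : ℝ) < 2 * g y} ν := fun l =>
    nullMeasurableSet_lt aemeasurable_const (hg.const_mul 2)
  calc (∫⁻ x, T x ^ (p * s) ∂μ) ^ (1 / s)
      ≤ (∑' l : ℤ, 2 ^ (((l : ℝ) + 1) * (p * s)) * μ (E l)) ^ (1 / s) := by gcongr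
    _ ≤ ∑' l : ℤ, (2 ^ (((l : ℝ) + 1) * (p * s)) * μ (E l)) ^ (1 / s) :=
        tsum_rpow_le_tsum_rpow _ (by positivity) (by rw [div_le_one hs0]; exact hs)
    _ = ∑' l : ℤ, 2 ^ p * 2 ^ ((l : ℝ) * (p - 1)) * (2 ^ (l : ℝ) * μ (E l) ^ (1 / s)) := by
        refine tsum_congr fun l => ?_
        rw [ENNReal.mul_rpow_of_nonneg _ _ (by positivity), ← ENNReal.rpow_mul,
          ← ENNReal.rpow_add _ _ (by norm_num) (by norm_num), ← mul_assoc (2 ^ (_ : ℝ) : ℝ≥0∞),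
          ← ENNReal.rpow_add _ _ (by norm_num) (by norm_num)]
        congr 2
        field_simp
        ring
    _ ≤ ∑' l : ℤ, 2 ^ p * 2 ^ ((l : ℝ) * (p - 1)) *
          (K * ∫⁻ y in {y | 2 ^ (l : ℝ) < 2 * g y}, g y ∂ν) := by
        exact ENNReal.tsum_le_tsum fun l => mul_le_mul_right (hweak l) _
    _ = 2 ^ p * K * ∑' l : ℤ, ∫⁻ y, g y * (2 ^ ((l : ℝ) * (p - 1)) *
          {l : ℤ | (2 : ℝ≥0∞) ^ (l : ℝ) < 2 * g y}.indicator 1 l) ∂ν := by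
        rw [← ENNReal.tsum_mul_left]
        refine tsum_congr fun l => ?_
        rw [← lintegral_indicator₀ (hset l)]
        have : ∀ y, g y * (2 ^ ((l : ℝ) * (p - 1)) *
            {l : ℤ | (2 : ℝ≥0∞) ^ (l : ℝ) < 2 * g y}.indicator 1 l) = 2 ^ ((l : ℝ) * (p - 1)) *
              {y | (2 : ℝ≥0∞) ^ (l : ℝ) < 2 * g y}.indicator g y := by
          intro y
          by_cases hy : (2 : ℝ≥0∞) ^ (l : ℝ) < 2 * g y
          · rw [indicator_of_mem (by exact hy), indicator_of_mem (by exact hy), Pi.one_apply]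
            ring
          · rw [indicator_of_notMem (by exact hy), indicator_of_notMem (by exact hy)]
            ring
        simp_rw [this]
        rw [lintegral_const_mul'' _ (hg.indicator₀ (hset l))]
        ring
    _ = 2 ^ p * K * ∫⁻ y, ∑' l : ℤ, g y * (2 ^ ((l : ℝ) * (p - 1)) *
          {l : ℤ | (2 : ℝ≥0∞) ^ (l : ℝ) < 2 * g y}.indicator 1 l) ∂ν := by
        rw [lintegral_tsum]
        intro l
        refine hg.mul (AEMeasurable.const_mul ?_ _)
        exact (aemeasurable_const (b := (1 : ℝ≥0∞))).indicator₀ (hset l)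
    _ ≤ 2 ^ p * K * ∫⁻ y, 2 ^ p * (1 - 2 ^ (-(p - 1)))⁻¹ * g y ^ p ∂ν := by
        gcongr with y
        rw [ENNReal.tsum_mul_left]
        calc g y * _ ≤ g y * ((1 - 2 ^ (-(p - 1)))⁻¹ * (2 * g y) ^ (p - 1)) := by
              gcongr
              exact tsum_dyadic_le_rpow (ENNReal.mul_ne_top (by norm_num) (hgtop y)) (by linarith)
          _ = 2 ^ (p - 1) * (1 - 2 ^ (-(p - 1)))⁻¹ * (g y ^ (1 : ℝ) * g y ^ (p - 1)) := by
              rw [ENNReal.mul_rpow_of_nonneg _ _ (by linarith), ENNReal.rpow_one]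
              ring
          _ = 2 ^ (p - 1) * (1 - 2 ^ (-(p - 1)))⁻¹ * g y ^ p := by
              rw [← ENNReal.rpow_add_of_nonneg _ _ (by norm_num) (by linarith)]
              ring_nf
          _ ≤ _ := by
              gcongr
              · norm_num
              · linarith
    _ = _ := by
        rw [lintegral_const_mul'' _ (hg.pow_const p), two_mul p,
          ENNReal.rpow_add _ _ (by norm_num) (by norm_num)]
        ring

end Interpolation

/-! ### Thickened faces compared with coordinate boxes. -/

section Geometry

variable {n k : ℕ}

theorem volume_setOf_forall_mem (I : Fin n → Set ℝ) :
    volume {y : EuclideanSpace ℝ (Fin n) | ∀ j, y j ∈ I j} = ∏ j, volume (I j) := by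
  have h := (PiLp.volume_preserving_ofLp (Fin n)).measure_preimage_emb
    (MeasurableEquiv.toLp 2 (Fin n → ℝ)).symm.measurableEmbedding (univ.pi I)
  rw [volume_pi, Measure.pi_pi] at h
  rw [← h]
  congr 1
  ext y
  simp [mem_pi]

theorem card_filter_ne_zero (hk : k ≤ n) (j : FaceIndex n k) :
    (Finset.univ.filter fun i => j.1 i ≠ 0).card = n - k := by
  have h := Finset.card_filter_add_card_filter_not (s := Finset.univ) (fun i => j.1 i = 0)
  rw [j.2, Finset.card_univ, Fintype.card_fin] at h
  have h' : (Finset.univ.filter fun i => ¬ j.1 i = 0).card = n - k := by omega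
  convert h'

theorem prod_ite_eq_zero (hk : k ≤ n) (j : FaceIndex n k) (a b : ℝ≥0∞) :
    ∏ i, (if j.1 i = 0 then a else b) = a ^ k * b ^ (n - k) := by
  rw [Finset.prod_ite, Finset.prod_const, Finset.prod_const, j.2, card_filter_ne_zero hk j]

theorem thickening_face_subset (j : FaceIndex n k) (x : EuclideanSpace ℝ (Fin n)) (r δ : ℝ) :
    Metric.thickening δ (face j x r) ⊆ {y | ∀ i, (j.1 i = 0 → |y i - x i| < r + δ) ∧
      (j.1 i ≠ 0 → |y i - (x i + (j.1 i : ℝ) * r)| < δ)} := by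
  intro y hy i
  obtain ⟨z, hz, hyz⟩ := Metric.mem_thickening_iff.1 hy
  have h1 : |y i - z i| < δ := by
    refine lt_of_le_of_lt ?_ hyz
    rw [dist_eq_norm, ← Real.norm_eq_abs]
    exact PiLp.norm_apply_le (y - z) i
  refine ⟨fun h0 => ?_, fun h0 => ?_⟩
  · have h2 := (hz i).1 h0
    have h3 := abs_sub_le (y i) (z i) (x i)
    linarith
  · rwa [← (hz i).2 h0]

/-- With tolerance `δ / n` per coordinate, the squared Euclidean distance to the face is below `n *
(δ / n) ^ 2 ≤ δ ^ 2`. -/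
theorem subset_thickening_face (hn : 0 < n) (j : FaceIndex n k) (x : EuclideanSpace ℝ (Fin n))
    (r : ℝ) {δ : ℝ} (hδ : 0 < δ) :
    {y : EuclideanSpace ℝ (Fin n) | ∀ i, y i ∈ if j.1 i = 0 then Ioo (x i - r) (x i + r) else
      Ioo (x i + (j.1 i : ℝ) * r - δ / n) (x i + (j.1 i : ℝ) * r + δ / n)} ⊆
      Metric.thickening δ (face j x r) := by
  intro y hy
  rw [Metric.mem_thickening_iff]
  have hn' : (1 : ℝ) ≤ n := by exact_mod_cast hn
  refine ⟨WithLp.toLp 2 fun i => if j.1 i = 0 then y i else x i + (j.1 i : ℝ) * r, ?_, ?_⟩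
  · intro i
    have := hy i
    by_cases h0 : j.1 i = 0
    · simp only [h0, if_true, mem_Ioo] at this
      refine ⟨fun _ => ?_, fun h => absurd h0 h⟩
      simp only [h0, if_true]
      rw [abs_le]
      constructor <;> linarith
    · exact ⟨fun h => absurd h h0, fun _ => by simp [h0]⟩
  · rw [EuclideanSpace.dist_eq, Real.sqrt_lt' hδ]
    have hlt : ∀ i ∈ (Finset.univ : Finset (Fin n)), dist (y i)
        (if j.1 i = 0 then y i else x i + (j.1 i : ℝ) * r) ^ 2 < (δ / n) ^ 2 := by
      intro i _
      have hpos : 0 < δ / n := by positivity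
      refine pow_lt_pow_left₀ ?_ dist_nonneg two_ne_zero
      have := hy i
      by_cases h0 : j.1 i = 0
      · simpa [h0] using hpos
      · simp only [h0, if_false, mem_Ioo] at this ⊢
        rw [Real.dist_eq, abs_lt]
        constructor <;> linarith
    refine (Finset.sum_lt_sum_of_nonempty ⟨⟨0, hn⟩, Finset.mem_univ _⟩ hlt).trans_le ?_
    rw [Finset.sum_const, Finset.card_univ, Fintype.card_fin, nsmul_eq_mul, div_pow]
    have : (n : ℝ) * (δ ^ 2 / n ^ 2) = δ ^ 2 / n := by field_simp
    rw [this]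
    exact div_le_self (by positivity) hn'

theorem le_volume_thickening_face (hk : k < n) (j : FaceIndex n k)
    (x : EuclideanSpace ℝ (Fin n)) {r δ : ℝ} (hr : 1 ≤ r) (hδ : 0 < δ) :
    ENNReal.ofReal ((δ / n) ^ (n - k)) ≤ volume (Metric.thickening δ (face j x r)) := by
  refine le_trans ?_ (measure_mono (subset_thickening_face (by omega) j x r hδ))
  rw [volume_setOf_forall_mem, ENNReal.ofReal_pow (by positivity), ← one_mul (_ ^ (n - k)),
    ← one_pow k, ← prod_ite_eq_zero hk.le j]
  refine Finset.prod_le_prod' fun i _ => ?_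
  split_ifs
  · rw [Real.volume_Ioo, ← ENNReal.ofReal_one]
    exact ENNReal.ofReal_le_ofReal (by linarith)
  · rw [Real.volume_Ioo]
    refine ENNReal.ofReal_le_ofReal ?_
    have : 0 < δ / n := by
      have : 0 < n := by omega
      positivity
    linarith

theorem volume_thickening_face_le (hk : k ≤ n) (j : FaceIndex n k)
    (x : EuclideanSpace ℝ (Fin n)) (r δ : ℝ) :
    volume (Metric.thickening δ (face j x r)) ≤
      ENNReal.ofReal (2 * (r + δ)) ^ k * ENNReal.ofReal (2 * δ) ^ (n - k) := by
  rw [← prod_ite_eq_zero hk j]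
  calc volume (Metric.thickening δ (face j x r))
      ≤ volume {y : EuclideanSpace ℝ (Fin n) | ∀ i, y i ∈ if j.1 i = 0 then
          Ioo (x i - (r + δ)) (x i + (r + δ)) else
          Ioo (x i + (j.1 i : ℝ) * r - δ) (x i + (j.1 i : ℝ) * r + δ)} := by
        refine measure_mono fun y hy i => ?_
        have := thickening_face_subset j x r δ hy i
        split_ifs with h0
        · have h1 := abs_lt.1 (this.1 h0)
          constructor <;> linarith
        · have h1 := abs_lt.1 (this.2 h0)
          constructor <;> linarith
    _ = _ := by
        rw [volume_setOf_forall_mem]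
        refine Finset.prod_congr rfl fun i _ => ?_
        split_ifs <;> rw [Real.volume_Ioo] <;> ring_nf

theorem volume_thickening_face_ne_top (hk : k ≤ n) (j : FaceIndex n k)
    (x : EuclideanSpace ℝ (Fin n)) (r δ : ℝ) :
    volume (Metric.thickening δ (face j x r)) ≠ ∞ :=
  ne_top_of_le_ne_top (ENNReal.mul_ne_top (ENNReal.pow_ne_top ENNReal.ofReal_ne_top)
    (ENNReal.pow_ne_top ENNReal.ofReal_ne_top)) (volume_thickening_face_le hk j x r δ)

end Geometry

/-! ### The weak type estimate from the counting theorem. -/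

section WeakType

theorem measurableSet_setOf_forall {α ι : Type*} [MeasurableSpace α] [Countable ι]
    {q : ι → α → Prop} (h : ∀ i, MeasurableSet {y | q i y}) : MeasurableSet {y | ∀ i, q i y} := by
  rw [ofPred_forall]
  exact MeasurableSet.iInter h

theorem tsum_measure_le_of_overlap {α ι : Type*} [MeasurableSpace α] [Countable ι]
    (ν : Measure α) {B : ι → Set α} (hB : ∀ i, MeasurableSet (B i)) (N : ℕ)
    (h : ∀ y, ∃ t : Finset ι, t.card ≤ N ∧ ∀ i, y ∈ B i → i ∈ t) :
    ∑' i, ν (B i) ≤ N * ν univ := by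
  calc ∑' i, ν (B i) = ∑' i, ∫⁻ y, (B i).indicator 1 y ∂ν := by
        simp_rw [lintegral_indicator_one (hB _)]
    _ = ∫⁻ y, ∑' i, (B i).indicator 1 y ∂ν :=
        (lintegral_tsum fun i => (measurable_one.indicator (hB i)).aemeasurable).symm
    _ ≤ ∫⁻ _, N ∂ν := by
        refine lintegral_mono fun y => ?_
        obtain ⟨t, ht, hmem⟩ := h y
        rw [tsum_eq_sum (s := t) fun i hi => indicator_of_notMem (fun hy => hi (hmem i hy)) _]
        calc ∑ i ∈ t, (B i).indicator (1 : α → ℝ≥0∞) y ≤ ∑ i ∈ t, 1 :=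
              Finset.sum_le_sum fun i _ => indicator_le_self' (fun _ _ => zero_le) _
          _ ≤ N := by
              rw [Finset.sum_const, nsmul_eq_mul, mul_one]
              exact_mod_cast ht
    _ = N * ν univ := by rw [lintegral_const]

variable {n k : ℕ}

theorem one_div_qStar (hk : k ≤ n) :
    1 / qStar n k = ((n - k : ℕ) * (2 * n - 1) : ℝ) / (2 * n ^ 2) := by
  rw [qStar, one_div_div, Nat.cast_sub hk]

/-- The local estimate: `P` consists of `δ`-cells, each meeting the unit cube with corner `Q` in an
admissible centre. The lower bound holds for every face, so one face label, chosen after counting,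
serves all the centres. -/
theorem rpow_card_mul_le (hk : k < n) (ν : Measure (EuclideanSpace ℝ (Fin n))) {δ : ℝ}
    (hδ : 0 < δ) (hδ1 : δ < 1) (a : ℝ≥0∞) (P : Finset (Fin n → ℤ)) (Q : Fin n → ℤ)
    (h : ∀ p ∈ P, ∃ x : EuclideanSpace ℝ (Fin n), (∀ j, ⌊x j / δ⌋ = p j) ∧ (∀ j, ⌊x j⌋ = Q j) ∧
      ∃ r ∈ Icc (1 : ℝ) 2, ∀ j : FaceIndex n k, a ≤ ν (Metric.thickening δ (face j x r))) :
    ENNReal.ofReal ((P.card : ℝ) ^ (1 / qStar n k)) * a ≤ 7 ^ n * ν {y | ∀ j, |y j - Q j| ≤ 4} := by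
  classical
  choose! x hx hxQ r hr ha using h
  obtain ⟨σ, hσ, J, hJ, hW⟩ := exists_card_rpow_le_card_image (by omega) P
    (fun p => ⌊r p / δ⌋) (m := n - k) (by omega) (by omega)
  rw [← one_div_qStar hk.le] at hW
  set W := P.image fun p j => if j ∈ J then p j + σ j * ⌊r p / δ⌋ else 0 with hWdef
  set D : Set (EuclideanSpace ℝ (Fin n)) := {y | ∀ j, |y j - Q j| ≤ 4} with hD
  -- A slab around a rounded face location. The tolerance `3` adds the thickening and the two floor
  -- errors, each below `1`. Off `J` the label must vanish, which keeps the overlap bounded.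
  let B : (Fin n → ℤ) → Set (EuclideanSpace ℝ (Fin n)) := fun w =>
    {y | ∀ j, if j ∈ J then |y j / δ - w j| < 3 else w j = 0}
  have hB : ∀ w, MeasurableSet (B w) := by
    intro w
    refine measurableSet_setOf_forall fun j => ?_
    split_ifs
    · exact measurableSet_lt (by fun_prop) measurable_const
    · exact MeasurableSet.const _
  let τ : FaceIndex n k := ⟨fun j => if j ∈ J then (if σ j = 1 then 1 else -1) else 0, by
    have : (Finset.univ.filter fun j => (if j ∈ J then (if σ j = 1 then (1 : SignType) else -1)
        else 0) = 0) = Jᶜ := by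
      ext j
      simp only [Finset.mem_filter, Finset.mem_univ, true_and, Finset.mem_compl]
      split_ifs <;> simp_all
    rw [this, Finset.card_compl, Fintype.card_fin, hJ]
    omega⟩
  have hτ : ∀ j ∈ J, τ.1 j ≠ 0 ∧ ((τ.1 j : SignType) : ℝ) = σ j := by
    intro j hj
    simp only [τ, hj, if_true]
    rcases hσ j with h | h <;> simp [h]
  have hsub : ∀ p ∈ P, Metric.thickening δ (face τ (x p) (r p)) ⊆
      B (fun j => if j ∈ J then p j + σ j * ⌊r p / δ⌋ else 0) ∩ D := by
    intro p hp y hy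
    have hy' := thickening_face_subset τ (x p) (r p) δ hy
    refine ⟨fun j => ?_, fun j => ?_⟩
    · by_cases hj : j ∈ J
      · obtain ⟨hτ0, hτσ⟩ := hτ j hj
        simp only [hj, if_true]
        have h1 := (hy' j).2 hτ0
        rw [hτσ] at h1
        have h2 : |y j / δ - (x p j / δ + σ j * (r p / δ))| < 1 := by
          have : y j / δ - (x p j / δ + σ j * (r p / δ)) = (y j - (x p j + σ j * r p)) / δ := by
            field_simp
          rw [this, abs_div, abs_of_pos hδ, div_lt_one hδ]
          exact h1
        have h3 := Int.floor_le (x p j / δ)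
        have h4 := Int.lt_floor_add_one (x p j / δ)
        have h5 := Int.floor_le (r p / δ)
        have h6 := Int.lt_floor_add_one (r p / δ)
        rw [hx p hp j] at h3 h4
        rw [abs_lt] at h2 ⊢
        rcases hσ j with h | h <;> rw [h] at h2 ⊢ <;> push_cast at h2 ⊢ <;>
          constructor <;> linarith
      · simp [hj]
    · have h3 := Int.floor_le (x p j)
      have h4 := Int.lt_floor_add_one (x p j)
      rw [hxQ p hp j] at h3 h4
      have h5 : |y j - x p j| < 3 := by
        by_cases hj : τ.1 j = 0
        · have := (hy' j).1 hj
          linarith [(hr p hp).2]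
        · have h6 := (hy' j).2 hj
          have h7 : |((τ.1 j : SignType) : ℝ) * r p| ≤ 2 := by
            have h8 : |((τ.1 j : SignType) : ℝ)| ≤ 1 := by
              cases τ.1 j <;> simp
            rw [abs_mul, abs_of_nonneg (by linarith [(hr p hp).1] : 0 ≤ r p)]
            nlinarith [(hr p hp).1, (hr p hp).2, abs_nonneg ((τ.1 j : SignType) : ℝ)]
          rw [abs_lt] at h6 ⊢
          rw [abs_le] at h7
          constructor <;> linarith
      rw [abs_lt] at h5
      rw [abs_le]
      constructor <;> linarith
  have hDm : MeasurableSet D :=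
    measurableSet_setOf_forall fun j => measurableSet_le (by fun_prop) measurable_const
  calc ENNReal.ofReal ((P.card : ℝ) ^ (1 / qStar n k)) * a ≤ W.card * a := by
        gcongr
        rw [← ENNReal.ofReal_natCast]
        exact ENNReal.ofReal_le_ofReal hW
    _ = ∑ w ∈ W, a := by rw [Finset.sum_const, nsmul_eq_mul]
    _ ≤ ∑ w ∈ W, (ν.restrict D) (B w) := by
        refine Finset.sum_le_sum fun w hw => ?_
        obtain ⟨p, hp, rfl⟩ := Finset.mem_image.1 hw
        rw [Measure.restrict_apply (hB _)]
        exact (ha p hp τ).trans (measure_mono (hsub p hp))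
    _ ≤ ∑' w, (ν.restrict D) (B w) := ENNReal.sum_le_tsum _
    _ ≤ (7 ^ n : ℕ) * (ν.restrict D) univ := by
        refine tsum_measure_le_of_overlap _ hB _ fun y => ?_
        refine ⟨Fintype.piFinset fun j => if j ∈ J then
          Finset.Icc (⌊y j / δ⌋ - 3) (⌊y j / δ⌋ + 3) else {0}, ?_, ?_⟩
        · rw [Fintype.card_piFinset]
          refine (Finset.prod_le_pow_card _ _ 7 fun j _ => ?_).trans (by simp)
          split_ifs
          · rw [Int.card_Icc]; omega
          · simp
        · intro w hw
          rw [Fintype.mem_piFinset]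
          intro j
          have := hw j
          split_ifs with hj
          · simp only [hj, if_true, abs_lt] at this
            have h3 := Int.floor_le (y j / δ)
            have h4 := Int.lt_floor_add_one (y j / δ)
            have h5 : (w j : ℝ) < ⌊y j / δ⌋ + 4 := by linarith
            have h6 : (⌊y j / δ⌋ : ℝ) - 3 < w j + 1 := by linarith
            have h7 : w j < ⌊y j / δ⌋ + 4 := by exact_mod_cast h5
            have h8 : ⌊y j / δ⌋ - 3 < w j + 1 := by exact_mod_cast h6
            rw [Finset.mem_Icc]
            omega
          · simpa [hj] using this
    _ = _ := by
        rw [Measure.restrict_apply_univ]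
        push_cast
        rfl

theorem volume_setOf_floor_eq {δ : ℝ} (hδ : 0 < δ) (p : Fin n → ℤ) :
    volume {y : EuclideanSpace ℝ (Fin n) | ∀ j, ⌊y j / δ⌋ = p j} = ENNReal.ofReal δ ^ n := by
  have : {y : EuclideanSpace ℝ (Fin n) | ∀ j, ⌊y j / δ⌋ = p j} =
      {y | ∀ j, y j ∈ Ico (p j * δ) ((p j + 1) * δ)} := by
    ext y
    refine forall_congr' fun j => ?_
    rw [Int.floor_eq_iff, le_div_iff₀ hδ, div_lt_iff₀ hδ, mem_Ico]
  rw [this, volume_setOf_forall_mem]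
  simp only [Real.volume_Ico]
  rw [Finset.prod_congr rfl fun j _ => by rw [show ((p j : ℝ) + 1) * δ - p j * δ = δ by ring]]
  simp

/-- The factor `X` is the cost of replacing the exponent `1 / s` by the exponent `1 / q*` that
counting provides; keeping it abstract treats both regimes at once. The constant `63` is `7 * 9`,
from the overlaps of slabs and of enlarged unit cubes. -/
theorem measure_rpow_mul_le (hk : k < n) (ν : Measure (EuclideanSpace ℝ (Fin n))) {δ : ℝ}
    (hδ : 0 < δ) (hδ1 : δ < 1) (a : ℝ≥0∞) (S : Set (EuclideanSpace ℝ (Fin n)))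
    (h : ∀ x ∈ S, ∃ r ∈ Icc (1 : ℝ) 2, ∀ j : FaceIndex n k,
      a ≤ ν (Metric.thickening δ (face j x r)))
    {s X : ℝ} (hs : 1 ≤ s) (hX0 : 0 ≤ X) (hX : ∀ N : ℕ, (N : ℝ) ≤ (3 / δ) ^ n →
      (N : ℝ) ^ (1 / s) ≤ X * (N : ℝ) ^ (1 / qStar n k)) :
    volume S ^ (1 / s) * a ≤ ENNReal.ofReal (δ ^ (n / s) * X * 63 ^ n) * ν univ := by
  classical
  have hs0 : 0 < s := by linarith
  let S' : (Fin n → ℤ) → Set (EuclideanSpace ℝ (Fin n)) := fun Q => {x ∈ S | ∀ j, ⌊x j⌋ = Q j}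
  let R : (Fin n → ℤ) → Finset (Fin n → ℤ) := fun Q =>
    Fintype.piFinset fun j => Finset.Icc ⌊Q j / δ⌋ ⌊(Q j + 1) / δ⌋
  let P : (Fin n → ℤ) → Finset (Fin n → ℤ) := fun Q =>
    (R Q).filter fun p => ∃ x ∈ S' Q, ∀ j, ⌊x j / δ⌋ = p j
  have hPcard : ∀ Q, ((P Q).card : ℝ) ≤ (3 / δ) ^ n := by
    intro Q
    calc ((P Q).card : ℝ) ≤ (R Q).card := by exact_mod_cast Finset.card_filter_le _ _
      _ = ∏ j, ((Finset.Icc ⌊Q j / δ⌋ ⌊(Q j + 1) / δ⌋).card : ℝ) := by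
          rw [Fintype.card_piFinset]
          push_cast
          rfl
      _ ≤ ∏ _j : Fin n, 3 / δ := by
          refine Finset.prod_le_prod (fun _ _ => by positivity) fun j _ => ?_
          have h1 := Int.floor_le ((Q j + 1) / δ)
          have h2 := Int.lt_floor_add_one (Q j / δ)
          have h3 : ⌊Q j / δ⌋ ≤ ⌊(Q j + 1) / δ⌋ := Int.floor_mono (by gcongr; linarith)
          have h4 : ((Finset.Icc ⌊Q j / δ⌋ ⌊(Q j + 1) / δ⌋).card : ℤ) =
              ⌊(Q j + 1) / δ⌋ + 1 - ⌊Q j / δ⌋ := Int.card_Icc_of_le _ _ (by omega)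
          have h5 : ((Finset.Icc ⌊Q j / δ⌋ ⌊(Q j + 1) / δ⌋).card : ℝ) =
              ⌊(Q j + 1) / δ⌋ + 1 - ⌊Q j / δ⌋ := by exact_mod_cast h4
          have h6 : (Q j + 1) / δ = Q j / δ + 1 / δ := by ring
          have h7 : 1 ≤ 1 / δ := by rw [le_div_iff₀ hδ]; linarith
          have h8 : 3 / δ = 3 * (1 / δ) := by ring
          rw [h5, h8]
          linarith
      _ = (3 / δ) ^ n := by rw [Finset.prod_const, Finset.card_univ, Fintype.card_fin]
  have hloc : ∀ Q, volume (S' Q) ^ (1 / s) * a ≤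
      ENNReal.ofReal (δ ^ (n / s) * X) * (7 ^ n * ν {y | ∀ j, |y j - Q j| ≤ 4}) := by
    intro Q
    have h1 : volume (S' Q) ≤ (P Q).card * ENNReal.ofReal δ ^ n := by
      have hcov : S' Q ⊆ ⋃ p ∈ P Q, {y | ∀ j, ⌊y j / δ⌋ = p j} := by
        intro y hy
        refine mem_biUnion (x := fun j => ⌊y j / δ⌋) ?_ (fun j => rfl)
        refine Finset.mem_coe.2 (Finset.mem_filter.2 ⟨Fintype.mem_piFinset.2 fun j => ?_,
          y, hy, fun j => rfl⟩)
        have h3 := Int.floor_le (y j)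
        have h4 := Int.lt_floor_add_one (y j)
        rw [hy.2 j] at h3 h4
        rw [Finset.mem_Icc]
        exact ⟨Int.floor_mono (by gcongr), Int.floor_mono (by gcongr)⟩
      refine (measure_mono hcov).trans ((measure_biUnion_finset_le _ _).trans ?_)
      simp_rw [volume_setOf_floor_eq hδ]
      rw [Finset.sum_const, nsmul_eq_mul]
    have h2 := rpow_card_mul_le hk ν hδ hδ1 a (P Q) Q (by
      intro p hp
      obtain ⟨x, hx, hxp⟩ := (Finset.mem_filter.1 hp).2
      exact ⟨x, hxp, hx.2, h x hx.1⟩)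
    calc volume (S' Q) ^ (1 / s) * a ≤ ((P Q).card * ENNReal.ofReal δ ^ n) ^ (1 / s) * a := by
          gcongr
      _ = ENNReal.ofReal (δ ^ (n / s) * ((P Q).card : ℝ) ^ (1 / s)) * a := by
          congr 1
          rw [← ENNReal.ofReal_natCast, ← ENNReal.ofReal_pow hδ.le,
            ← ENNReal.ofReal_mul (by positivity),
            ENNReal.ofReal_rpow_of_nonneg (by positivity) (by positivity)]
          congr 1
          rw [Real.mul_rpow (by positivity) (by positivity), ← Real.rpow_natCast δ n,
            ← Real.rpow_mul hδ.le, mul_comm, mul_one_div]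
      _ ≤ ENNReal.ofReal (δ ^ (n / s) * (X * ((P Q).card : ℝ) ^ (1 / qStar n k))) * a := by
          gcongr
          exact hX _ (hPcard Q)
      _ = ENNReal.ofReal (δ ^ (n / s) * X) *
            (ENNReal.ofReal (((P Q).card : ℝ) ^ (1 / qStar n k)) * a) := by
          rw [← mul_assoc (δ ^ (n / s)), ENNReal.ofReal_mul (by positivity), mul_assoc]
      _ ≤ _ := by gcongr
  have hcov : S ⊆ ⋃ Q, S' Q := fun x hx => mem_iUnion.2 ⟨fun j => ⌊x j⌋, hx, fun _ => rfl⟩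
  calc volume S ^ (1 / s) * a ≤ (∑' Q, volume (S' Q)) ^ (1 / s) * a := by
        gcongr
        exact (measure_mono hcov).trans (measure_iUnion_le _)
    _ ≤ (∑' Q, volume (S' Q) ^ (1 / s)) * a := by
        gcongr
        -- The condition `p ≤ q` enters here, as `1 ≤ s`: it lets the local estimates be summed over
        -- unit cubes.
        exact tsum_rpow_le_tsum_rpow _ (by positivity) (by rw [div_le_one hs0]; exact hs)
    _ = ∑' Q, volume (S' Q) ^ (1 / s) * a := ENNReal.tsum_mul_right.symm
    _ ≤ ∑' Q : Fin n → ℤ, ENNReal.ofReal (δ ^ (n / s) * X) *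
          (7 ^ n * ν {y | ∀ j, |y j - Q j| ≤ 4}) := ENNReal.tsum_le_tsum hloc
    _ = ENNReal.ofReal (δ ^ (n / s) * X) *
          (7 ^ n * ∑' Q : Fin n → ℤ, ν {y | ∀ j, |y j - Q j| ≤ 4}) := by
        rw [ENNReal.tsum_mul_left, ENNReal.tsum_mul_left]
    _ ≤ ENNReal.ofReal (δ ^ (n / s) * X) * (7 ^ n * ((9 ^ n : ℕ) * ν univ)) := by
        gcongr
        refine tsum_measure_le_of_overlap _ (fun Q => measurableSet_setOf_forall fun j =>
          measurableSet_le (by fun_prop) measurable_const) _ fun y => ?_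
        refine ⟨Fintype.piFinset fun j => Finset.Icc (⌊y j⌋ - 4) (⌊y j⌋ + 4), ?_, ?_⟩
        · rw [Fintype.card_piFinset]
          refine (Finset.prod_le_pow_card _ _ 9 fun j _ => ?_).trans (by simp)
          rw [Int.card_Icc]; omega
        · intro w hw
          rw [Fintype.mem_piFinset]
          intro j
          have := abs_le.1 (hw j)
          have h3 := Int.floor_le (y j)
          have h4 := Int.lt_floor_add_one (y j)
          have h5 : (w j : ℝ) < ⌊y j⌋ + 5 := by linarith
          have h6 : (⌊y j⌋ : ℝ) - 4 < w j + 1 := by linarith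
          have h7 : w j < ⌊y j⌋ + 5 := by exact_mod_cast h5
          have h8 : ⌊y j⌋ - 4 < w j + 1 := by exact_mod_cast h6
          rw [Finset.mem_Icc]
          omega
    _ = _ := by
        rw [ENNReal.ofReal_mul (p := δ ^ (n / s) * X) (by positivity), ENNReal.ofReal_pow (by norm_num),
          show (63 : ℝ) = 7 * 9 by norm_num, ENNReal.ofReal_mul (p := 7) (by norm_num), mul_pow]
        simp only [ENNReal.ofReal_ofNat, Nat.cast_pow, Nat.cast_ofNat]
        ring

end WeakType

/-! ### Operator norm bounds from above, uniformly in `δ`, `s` and `X`. -/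

section Upper

variable {n k : ℕ}

theorem two_rpow_eq_two_mul (l : ℝ) : (2 : ℝ≥0∞) ^ l = 2 * 2 ^ (l - 1) := by
  calc (2 : ℝ≥0∞) ^ l = 2 ^ (1 + (l - 1)) := by ring_nf
    _ = 2 * 2 ^ (l - 1) := by
      rw [ENNReal.rpow_add _ _ (by norm_num) (by norm_num), ENNReal.rpow_one]

/-- Where `|f|` is at most half the level, it contributes at most half the level to an average. The
other half must come from the truncated function. -/
theorem le_withDensity_thickening_of_lt_skeletonMaximal (hk : k < n) {δ : ℝ} (hδ : 0 < δ)
    (f : EuclideanSpace ℝ (Fin n) → ℝ) (l : ℝ) (x : EuclideanSpace ℝ (Fin n))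
    (hx : 2 ^ l < skeletonMaximal k δ f x) :
    ∃ r ∈ Icc (1 : ℝ) 2, ∀ j : FaceIndex n k,
      2 ^ (l - 1) * ENNReal.ofReal ((δ / n) ^ (n - k)) ≤
        (volume.withDensity ({y | 2 ^ l < 2 * ‖f y‖ₑ}.indicator fun y => ‖f y‖ₑ))
          (Metric.thickening δ (face j x r)) := by
  simp only [skeletonMaximal, lt_iSup_iff] at hx
  obtain ⟨r, hr, hlt⟩ := hx
  refine ⟨r, hr, fun j => ?_⟩
  have hj := (hlt.trans_le (iInf_le _ j)).le
  rw [setLAverage_eq] at hj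
  set S := Metric.thickening δ (face j x r) with hS
  rw [withDensity_apply _ Metric.isOpen_thickening.measurableSet]
  have h2 : (2 : ℝ≥0∞) ^ l = 2 ^ (l - 1) + 2 ^ (l - 1) := by
    rw [← two_mul, two_rpow_eq_two_mul]
  have hpt : ∀ y, ‖f y‖ₑ ≤
      ({y | (2 : ℝ≥0∞) ^ l < 2 * ‖f y‖ₑ}.indicator fun y => ‖f y‖ₑ) y + 2 ^ (l - 1) := by
    intro y
    by_cases hy : (2 : ℝ≥0∞) ^ l < 2 * ‖f y‖ₑ
    · rw [indicator_of_mem (by exact hy)]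
      exact le_self_add
    · rw [indicator_of_notMem (by exact hy), zero_add]
      rw [not_lt, h2, ← two_mul] at hy
      exact (ENNReal.mul_le_mul_iff_right (by norm_num) (by norm_num)).1 hy
  have hvol : volume S ≠ ∞ := volume_thickening_face_ne_top hk.le j x r δ
  have h3 : 2 ^ (l - 1) * volume S + 2 ^ (l - 1) * volume S ≤
      (∫⁻ y in S, ({y | (2 : ℝ≥0∞) ^ l < 2 * ‖f y‖ₑ}.indicator fun y => ‖f y‖ₑ) y) +
        2 ^ (l - 1) * volume S := by
    rw [← add_mul, ← h2]
    refine (ENNReal.mul_le_of_le_div hj).trans ((lintegral_mono hpt).trans ?_)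
    rw [lintegral_add_right _ measurable_const, setLIntegral_const]
  refine le_trans ?_ ((ENNReal.add_le_add_iff_right (ENNReal.mul_ne_top (by simp) hvol)).1 h3)
  gcongr
  exact le_volume_thickening_face hk j x hr.1 hδ

theorem exists_skeletonMaximalNorm_le (hk : k < n) {p : ℝ} (hp : 1 < p) :
    ∃ A : ℝ, 0 < A ∧ ∀ δ s X : ℝ, 0 < δ → δ < 1 → 1 ≤ s → 0 ≤ X →
      (∀ N : ℕ, (N : ℝ) ≤ (3 / δ) ^ n → (N : ℝ) ^ (1 / s) ≤ X * (N : ℝ) ^ (1 / qStar n k)) →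
      skeletonMaximalNorm n k δ p (p * s) ≤
        ENNReal.ofReal ((A * (δ ^ (n / s) * X / δ ^ (n - k))) ^ (1 / p)) := by
  have hp0 : 0 < p := by linarith
  have hn : (0 : ℝ) < n := by exact_mod_cast (by omega : 0 < n)
  have hlt1 : (2 : ℝ≥0∞) ^ (-(p - 1)) < 1 :=
    ENNReal.rpow_lt_one_of_one_lt_of_neg (by norm_num) (by linarith)
  set a : ℝ≥0∞ := 2 ^ (2 * p) * (1 - 2 ^ (-(p - 1)))⁻¹ with ha
  have ha_top : a ≠ ∞ := by
    refine ENNReal.mul_ne_top (by simp) (ENNReal.inv_ne_top.2 ?_)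
    exact (tsub_pos_of_lt hlt1).ne'
  have ha0 : a ≠ 0 := by
    refine mul_ne_zero (by simp) (ENNReal.inv_ne_zero.2 ?_)
    exact (tsub_le_self.trans_lt ENNReal.one_lt_top).ne
  have haR : 0 < a.toReal := ENNReal.toReal_pos ha0 ha_top
  refine ⟨a.toReal * (2 * 63 ^ n * n ^ (n - k)), by positivity, ?_⟩
  intro δ s X hδ hδ1 hs hX0 hX
  have hs0 : 0 < s := by linarith
  refine iSup₂_le fun f hf => ?_
  obtain ⟨hfL, -⟩ := hf
  set M : ℝ := δ ^ (n / s) * X * 63 ^ n with hM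
  set d : ℝ := (δ / n) ^ (n - k) with hd
  have hd0 : 0 < d := by positivity
  have hM0 : 0 ≤ M := by positivity
  set g : EuclideanSpace ℝ (Fin n) → ℝ≥0∞ := fun y => ‖f y‖ₑ with hg
  have hgm : AEMeasurable g volume := hfL.1.enorm
  have hweak : ∀ l : ℤ, 2 ^ (l : ℝ) * volume {x | 2 ^ (l : ℝ) < skeletonMaximal k δ f x} ^ (1 / s) ≤
      ENNReal.ofReal (2 * M / d) * ∫⁻ y in {y | 2 ^ (l : ℝ) < 2 * g y}, g y := by
    intro l
    have h1 := measure_rpow_mul_le hk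
      (volume.withDensity ({y | (2 : ℝ≥0∞) ^ (l : ℝ) < 2 * g y}.indicator g)) hδ hδ1
      (2 ^ ((l : ℝ) - 1) * ENNReal.ofReal d) {x | 2 ^ (l : ℝ) < skeletonMaximal k δ f x}
      (fun x hx => le_withDensity_thickening_of_lt_skeletonMaximal hk hδ f l x hx) hs hX0 hX
    rw [withDensity_apply _ MeasurableSet.univ, Measure.restrict_univ,
      lintegral_indicator₀ (nullMeasurableSet_lt aemeasurable_const (hgm.const_mul 2))] at h1
    have hd' : ENNReal.ofReal d ≠ 0 := (ENNReal.ofReal_pos.2 hd0).ne'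
    rw [← ENNReal.mul_le_mul_iff_right hd' ENNReal.ofReal_ne_top]
    calc ENNReal.ofReal d * (2 ^ (l : ℝ) *
          volume {x | 2 ^ (l : ℝ) < skeletonMaximal k δ f x} ^ (1 / s))
        = 2 * (volume {x | 2 ^ (l : ℝ) < skeletonMaximal k δ f x} ^ (1 / s) *
          (2 ^ ((l : ℝ) - 1) * ENNReal.ofReal d)) := by
          rw [two_rpow_eq_two_mul (l : ℝ)]
          ring
      _ ≤ 2 * (ENNReal.ofReal M * ∫⁻ y in {y | 2 ^ (l : ℝ) < 2 * g y}, g y) := by gcongr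
      _ = _ := by
          rw [← mul_assoc, ← mul_assoc, ← ENNReal.ofReal_mul hd0.le,
            show d * (2 * M / d) = 2 * M by field_simp, ENNReal.ofReal_mul (p := 2) (by norm_num),
            ENNReal.ofReal_ofNat]
  have hstrong := lintegral_rpow_le_of_weak_type hgm (fun y => enorm_ne_top) hp hs hweak
  have hps : 0 < p * s := by positivity
  refine ENNReal.div_le_of_le_mul ?_
  rw [eLpNorm_eq_lintegral_rpow_enorm_toReal (by simpa using hps) ENNReal.ofReal_ne_top,
    eLpNorm_eq_lintegral_rpow_enorm_toReal (by simpa using hp0) ENNReal.ofReal_ne_top,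
    ENNReal.toReal_ofReal hps.le, ENNReal.toReal_ofReal hp0.le]
  simp only [enorm_eq_self]
  have hexp : 1 / (p * s) = 1 / s * (1 / p) := by field_simp
  rw [hexp, ENNReal.rpow_mul]
  refine (ENNReal.rpow_le_rpow hstrong (by positivity)).trans (le_of_eq ?_)
  rw [ENNReal.mul_rpow_of_nonneg _ _ (by positivity)]
  congr 1
  rw [← ENNReal.ofReal_rpow_of_nonneg (by positivity) (by positivity), ← ha,
    ← ENNReal.ofReal_toReal ha_top, ← ENNReal.ofReal_mul haR.le, ENNReal.toReal_ofReal haR.le]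
  congr 2
  rw [hM, hd, div_pow]
  field_simp

end Upper

/-! ### Lower bounds by indicator functions, and the single-skeleton example. -/

section Lower

variable {n k : ℕ}

theorem nonempty_faceIndex (hk : k ≤ n) : Nonempty (FaceIndex n k) := by
  obtain ⟨J, -, hJ⟩ := Finset.exists_subset_card_eq (s := (Finset.univ : Finset (Fin n))) (n := k)
    (by simpa using hk)
  classical
  refine ⟨⟨fun i => if i ∈ J then 0 else 1, ?_⟩⟩
  rw [← hJ]
  congr 1
  ext i
  by_cases h : i ∈ J <;> simp [h]

/-- For the indicator of `F` the maximal function is at least `1` on `G`, so the norm is at least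
`|G|^(1/q) / |F|^(1/p)`. -/
theorem le_skeletonMaximalNorm (hk : k < n) {δ p q : ℝ} (hδ : 0 < δ) (hp : 0 < p) (hq : 0 < q)
    {F G : Set (EuclideanSpace ℝ (Fin n))} (hF : MeasurableSet F) (hG : MeasurableSet G)
    (hGne : G.Nonempty)
    (h : ∀ x ∈ G, ∃ r ∈ Icc (1 : ℝ) 2, ∀ j : FaceIndex n k, Metric.thickening δ (face j x r) ⊆ F)
    {u v : ℝ} (hu : 0 ≤ u) (hv : 0 < v) (hGu : ENNReal.ofReal u ≤ volume G)
    (hFv : volume F ≤ ENNReal.ofReal v) :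
    ENNReal.ofReal (u ^ (1 / q) / v ^ (1 / p)) ≤ skeletonMaximalNorm n k δ p q := by
  have hn : (0 : ℝ) < n := by exact_mod_cast (by omega : 0 < n)
  have hpos : ∀ x r, 1 ≤ r → ∀ j : FaceIndex n k,
      volume (Metric.thickening δ (face j x r)) ≠ 0 := fun x r hr j =>
    ((ENNReal.ofReal_pos.2 (by positivity)).trans_le
      (le_volume_thickening_face hk j x hr hδ)).ne'
  have hF0 : volume F ≠ 0 := by
    obtain ⟨x, hx⟩ := hGne
    obtain ⟨r, hr, hsub⟩ := h x hx
    obtain ⟨j⟩ := nonempty_faceIndex hk.le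
    exact fun h0 => hpos x r hr.1 j (measure_mono_null (hsub j) h0)
  have hFtop : volume F ≠ ∞ := ne_top_of_le_ne_top ENNReal.ofReal_ne_top hFv
  set f : EuclideanSpace ℝ (Fin n) → ℝ := F.indicator fun _ => 1 with hf
  have hp' : ENNReal.ofReal p ≠ 0 := by simpa using hp
  have hq' : ENNReal.ofReal q ≠ 0 := by simpa using hq
  have hfp : eLpNorm f (ENNReal.ofReal p) volume = volume F ^ (1 / p) := by
    rw [hf, eLpNorm_indicator_const hF hp' ENNReal.ofReal_ne_top, ENNReal.toReal_ofReal hp.le]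
    simp
  have hmem : f ∈ {f : EuclideanSpace ℝ (Fin n) → ℝ |
      MemLp f (ENNReal.ofReal p) volume ∧ ¬ f =ᵐ[volume] 0} := by
    refine ⟨memLp_indicator_const _ hF _ (Or.inr hFtop), fun h0 => hF0 ?_⟩
    have h1 := eLpNorm_congr_ae (p := ENNReal.ofReal p) h0
    rw [hfp, eLpNorm_zero, ENNReal.rpow_eq_zero_iff] at h1
    rcases h1 with h1 | h1
    · exact h1.1
    · exact absurd h1.1 hFtop
  have hone : ∀ x ∈ G, 1 ≤ skeletonMaximal k δ f x := by
    intro x hx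
    obtain ⟨r, hr, hsub⟩ := h x hx
    refine le_iSup₂_of_le r hr (le_iInf fun j => ?_)
    rw [setLAverage_eq]
    have h1 : ∫⁻ y in Metric.thickening δ (face j x r), ‖f y‖ₑ =
        volume (Metric.thickening δ (face j x r)) := by
      rw [← setLIntegral_one]
      refine setLIntegral_congr_fun Metric.isOpen_thickening.measurableSet fun y hy => ?_
      simp [hf, indicator_of_mem (hsub j hy)]
    rw [h1, ENNReal.div_self (hpos x r hr.1 j) (volume_thickening_face_ne_top hk.le j x r δ)]
  refine le_trans ?_ (le_iSup₂_of_le f hmem le_rfl)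
  rw [hfp, eLpNorm_eq_lintegral_rpow_enorm_toReal hq' ENNReal.ofReal_ne_top,
    ENNReal.toReal_ofReal hq.le, ENNReal.ofReal_div_of_pos (by positivity),
    ← ENNReal.ofReal_rpow_of_nonneg hu (by positivity),
    ← ENNReal.ofReal_rpow_of_nonneg hv.le (by positivity)]
  gcongr
  refine hGu.trans ?_
  calc volume G = ∫⁻ _ in G, 1 := by rw [setLIntegral_one]
    _ ≤ ∫⁻ x in G, ‖skeletonMaximal k δ f x‖ₑ ^ q := by
        refine setLIntegral_mono' hG fun x hx => ?_
        exact ENNReal.one_le_rpow (hone x hx) hq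
    _ ≤ _ := setLIntegral_le_lintegral _ _

theorem exists_le_skeletonMaximalNorm_of_ball (hk : k < n) {p q : ℝ} (hp : 0 < p) (hq : 0 < q) :
    ∃ c : ℝ, 0 < c ∧ ∀ δ : ℝ, 0 < δ → δ < 1 →
      ENNReal.ofReal (c * δ ^ ((n : ℝ) / q - ((n : ℝ) - k) / p)) ≤ skeletonMaximalNorm n k δ p q := by
  have : Finite (FaceIndex n k) := by unfold FaceIndex; infer_instance
  have := Fintype.ofFinite (FaceIndex n k)
  have := nonempty_faceIndex hk.le
  have hn : 0 < n := by omega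
  set β := (volume (Metric.ball (0 : EuclideanSpace ℝ (Fin n)) 1)).toReal with hβ
  have hβtop : volume (Metric.ball (0 : EuclideanSpace ℝ (Fin n)) 1) ≠ ∞ := measure_ball_lt_top.ne
  have hβ0 : 0 < β := ENNReal.toReal_pos (Metric.measure_ball_pos _ _ one_pos).ne' hβtop
  set V : ℝ := Fintype.card (FaceIndex n k) * (6 ^ k * 4 ^ (n - k)) with hV
  have hV0 : 0 < V := by
    have : 0 < Fintype.card (FaceIndex n k) := Fintype.card_pos
    positivity
  refine ⟨β ^ (1 / q) / V ^ (1 / p), by positivity, fun δ hδ hδ1 => ?_⟩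
  have hconv : β ^ (1 / q) / V ^ (1 / p) * δ ^ ((n : ℝ) / q - ((n : ℝ) - k) / p) =
      (δ ^ n * β) ^ (1 / q) / (V * δ ^ (n - k)) ^ (1 / p) := by
    rw [Real.mul_rpow (by positivity) hβ0.le, Real.mul_rpow hV0.le (by positivity),
      ← Real.rpow_natCast, ← Real.rpow_natCast, ← Real.rpow_mul hδ.le, ← Real.rpow_mul hδ.le,
      Nat.cast_sub hk.le, mul_one_div, mul_one_div, Real.rpow_sub hδ]
    ring
  rw [hconv]
  refine le_skeletonMaximalNorm hk hδ hp hq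
    -- Moving the centre by less than `δ` moves each face by less than `δ`, hence the width `2 * δ`.
    (F := ⋃ j : FaceIndex n k, Metric.thickening (2 * δ) (face j 0 1)) (G := Metric.ball 0 δ)
    (MeasurableSet.iUnion fun j => Metric.isOpen_thickening.measurableSet) measurableSet_ball
    ⟨0, by simpa using hδ⟩ ?_ (by positivity) (by positivity) ?_ ?_
  · intro x hx
    refine ⟨1, by norm_num, fun j => subset_iUnion_of_subset j ?_⟩
    intro y hy
    rw [Metric.mem_thickening_iff] at hy ⊢
    obtain ⟨z, hz, hyz⟩ := hy
    refine ⟨z - x, fun i => ⟨fun h0 => ?_, fun h0 => ?_⟩, ?_⟩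
    · simpa using (hz i).1 h0
    · simp [(hz i).2 h0]
    · have h1 : dist z (z - x) < δ := by
        rw [dist_eq_norm]
        simpa using hx
      linarith [dist_triangle y z (z - x)]
  · rw [Measure.addHaar_ball_of_pos _ _ hδ, ENNReal.ofReal_mul (by positivity), hβ,
      ENNReal.ofReal_toReal hβtop, finrank_euclideanSpace, Fintype.card_fin]
  · refine (measure_iUnion_le _).trans ?_
    rw [tsum_fintype]
    refine (Finset.sum_le_sum fun j _ => volume_thickening_face_le hk.le j 0 1 (2 * δ)).trans ?_
    rw [Finset.sum_const, Finset.card_univ, nsmul_eq_mul, ← ENNReal.ofReal_pow (by positivity),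
      ← ENNReal.ofReal_pow (by positivity), ← ENNReal.ofReal_natCast,
      ← ENNReal.ofReal_mul (by positivity), ← ENNReal.ofReal_mul (by positivity)]
    refine ENNReal.ofReal_le_ofReal ?_
    rw [hV, mul_assoc, mul_assoc, ← mul_pow]
    have h6 : 2 * (1 + 2 * δ) ≤ 6 := by linarith
    have h4 : 2 * (2 * δ) = 4 * δ := by ring
    rw [h4]
    gcongr

end Lower

/-! ### A thin set of reals containing prescribed translates, by digits. -/

section Arithmetic

/-- Consecutive digits of the translation parameter can be chosen so that each of the translates
has a prescribed digit equal to zero. -/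
theorem exists_nat_forall_fract_lt {δ : ℝ} (hδ : 0 < δ) {b : ℕ} (hb : 0 < b) (y : ℕ → ℝ) (t : ℕ) :
    ∃ s : ℕ, s < b ^ t ∧ ∀ i < t, ∃ m : ℤ, 0 ≤ y i + δ * s - m * (δ * b ^ (i + 1)) ∧
      y i + δ * s - m * (δ * b ^ (i + 1)) < δ * b ^ i := by
  induction t with
  | zero => exact ⟨0, by simp, fun i hi => absurd hi (by omega)⟩
  | succ t ih =>
    obtain ⟨s, hs, hdig⟩ := ih
    have hb' : (0 : ℝ) < b := by exact_mod_cast hb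
    have hbz : (0 : ℤ) < b := by exact_mod_cast hb
    set q := ⌊(y t + δ * s) / (δ * b ^ t)⌋ with hq
    -- The new digit `e` makes `q + e` divisible by `b`. For `i < t` it adds an integer multiple of
    -- `δ * b ^ (i + 1)`, so the earlier conditions survive.
    obtain ⟨e, he⟩ := Int.eq_ofNat_of_zero_le (Int.emod_nonneg (-q) hbz.ne')
    have heb : e < b := by
      have := Int.emod_lt_of_pos (-q) hbz
      omega
    refine ⟨s + e * b ^ t, ?_, fun i hi => ?_⟩
    · calc s + e * b ^ t < b ^ t + e * b ^ t := by omega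
        _ = (e + 1) * b ^ t := by ring
        _ ≤ b * b ^ t := Nat.mul_le_mul_right _ heb
        _ = b ^ (t + 1) := by ring
    · rcases Nat.lt_succ_iff_lt_or_eq.1 hi with hlt | rfl
      · obtain ⟨m, hm1, hm2⟩ := hdig i hlt
        obtain ⟨d, rfl⟩ := Nat.exists_eq_add_of_lt hlt
        have heq : y i + δ * ((s + e * b ^ (i + d + 1) : ℕ) : ℝ) -
            ((m + e * b ^ d : ℤ) : ℝ) * (δ * b ^ (i + 1)) =
            y i + δ * s - m * (δ * b ^ (i + 1)) := by
          push_cast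
          ring
        refine ⟨m + e * b ^ d, ?_, ?_⟩ <;> rw [heq] <;> assumption
      · have hdiv := Int.emod_add_mul_ediv (-q) b
        rw [he] at hdiv
        set m' := -q / (b : ℤ) with hm'
        have hdiv' : (e : ℝ) + b * m' = -q := by exact_mod_cast hdiv
        have heq : y i + δ * ((s + e * b ^ i : ℕ) : ℝ) - ((-m' : ℤ) : ℝ) * (δ * b ^ (i + 1)) =
            y i + δ * s - q * (δ * b ^ i) := by
          push_cast
          have : (q : ℝ) = -(e + b * m') := by linarith
          rw [this]
          ring
        have hpos : 0 < δ * (b : ℝ) ^ i := by positivity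
        have h1 := (le_div_iff₀ hpos).1 (Int.floor_le ((y i + δ * s) / (δ * b ^ i)))
        have h2 := (div_lt_iff₀ hpos).1 (Int.lt_floor_add_one ((y i + δ * s) / (δ * b ^ i)))
        rw [← hq] at h1 h2
        refine ⟨-m', ?_, ?_⟩ <;> rw [heq] <;> linarith

/-- `D` is made of the bounded reals which, in units of `δ` and base `b ≈ δ^(-1/t)`, have one of
their first `t` digits zero, thickened by `δ`. Each digit condition has density about `1 / b`, and
the digits of `r` are free to satisfy the `i`-th condition at `y i + r`. -/
theorem exists_thin_set {t : ℕ} (ht : 0 < t) {δ : ℝ} (hδ : 0 < δ) (hδ1 : δ < 1) :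
    ∃ D : Set ℝ, MeasurableSet D ∧ volume D ≤ ENNReal.ofReal (54 * t * δ ^ (1 / t : ℝ)) ∧
      ∀ y : ℕ → ℝ, (∀ i < t, |y i| ≤ 1) → ∃ r ∈ Icc (1 : ℝ) 2, ∀ i < t, ∀ u,
        |u - (y i + r)| < δ → u ∈ D := by
  have ht' : (0 : ℝ) < t := by exact_mod_cast ht
  set ρ := δ ^ (1 / t : ℝ) with hρ
  have hρ0 : 0 < ρ := by positivity
  have hρ1 : ρ ≤ 1 := Real.rpow_le_one hδ.le hδ1.le (by positivity)
  have hρt : ρ ^ t = δ := by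
    rw [hρ, ← Real.rpow_natCast, ← Real.rpow_mul hδ.le, one_div_mul_cancel ht'.ne', Real.rpow_one]
  have h1ρ : 1 ≤ 1 / ρ := by rwa [le_div_iff₀ hρ0, one_mul]
  set b := ⌊1 / ρ⌋₊ with hb
  have hb1 : 1 ≤ b := Nat.le_floor (by simpa using h1ρ)
  have hb1' : (1 : ℝ) ≤ b := by exact_mod_cast hb1
  have hble : (b : ℝ) ≤ 1 / ρ := Nat.floor_le (by positivity)
  have hbge : 1 / (b : ℝ) ≤ 2 * ρ := by
    have := Nat.lt_floor_add_one (1 / ρ)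
    rw [← hb] at this
    have h2 : 1 / ρ ≤ 2 * b := by linarith
    rw [div_le_iff₀ hρ0] at h2
    rw [div_le_iff₀ (by linarith)]
    linarith
  have hδb : δ * (b : ℝ) ^ t ≤ 1 := by
    calc δ * (b : ℝ) ^ t ≤ δ * (1 / ρ) ^ t := by gcongr
      _ = 1 := by rw [div_pow, hρt, one_pow, mul_one_div_cancel hδ.ne']
  have hle1 : ∀ i ≤ t, δ * (b : ℝ) ^ i ≤ 1 := fun i hi =>
    (mul_le_mul_of_nonneg_left (pow_le_pow_right₀ hb1' hi) hδ.le).trans hδb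
  let I : ℕ → ℤ → Set ℝ := fun i m =>
    Ioo (m * (δ * b ^ (i + 1)) - δ) (m * (δ * b ^ (i + 1)) + δ * b ^ i + δ)
  -- The points `y i + r` lie in `[0, 3]` and block lengths are at most `1`, so multiples of
  -- absolute value at most `4` suffice.
  let M : ℕ → ℤ := fun i => ⌊4 / (δ * (b : ℝ) ^ (i + 1))⌋
  refine ⟨⋃ i ∈ Finset.range t, ⋃ m ∈ Finset.Icc (-M i) (M i), I i m, ?_, ?_, ?_⟩
  · exact Finset.measurableSet_biUnion _ fun i _ =>
      Finset.measurableSet_biUnion _ fun m _ => measurableSet_Ioo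
  · have hi : ∀ i ∈ Finset.range t, volume (⋃ m ∈ Finset.Icc (-M i) (M i), I i m) ≤
        ENNReal.ofReal (54 * ρ) := by
      intro i hi
      rw [Finset.mem_range] at hi
      set h := δ * (b : ℝ) ^ (i + 1) with hh
      have hh0 : 0 < h := by positivity
      have hh1 : h ≤ 1 := hle1 _ hi
      refine (measure_biUnion_finset_le _ _).trans ?_
      have hvol : ∀ m ∈ Finset.Icc (-M i) (M i), volume (I i m) =
          ENNReal.ofReal (δ * b ^ i + 2 * δ) := by
        intro m _
        rw [Real.volume_Ioo]
        congr 1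
        ring
      rw [Finset.sum_congr rfl hvol, Finset.sum_const, nsmul_eq_mul, ← ENNReal.ofReal_natCast,
        ← ENNReal.ofReal_mul (by positivity)]
      refine ENNReal.ofReal_le_ofReal ?_
      have hM0 : 0 ≤ M i := Int.floor_nonneg.2 (by positivity)
      have hcard : ((Finset.Icc (-M i) (M i)).card : ℝ) = 2 * M i + 1 := by
        have : ((Finset.Icc (-M i) (M i)).card : ℤ) = 2 * M i + 1 := by
          rw [Int.card_Icc_of_le _ _ (by omega)]; ring
        exact_mod_cast this
      have hMle : (M i : ℝ) ≤ 4 / h := Int.floor_le _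
      have h1h : 1 ≤ 1 / h := by rwa [le_div_iff₀ hh0, one_mul]
      have hc9 : 2 * (M i : ℝ) + 1 ≤ 9 / h := by
        have e1 : 4 / h = 4 * (1 / h) := by ring
        have e2 : 9 / h = 9 * (1 / h) := by ring
        linarith
      have hδi : δ ≤ δ * b ^ i := le_mul_of_one_le_right hδ.le (one_le_pow₀ hb1')
      rw [hcard]
      calc (2 * (M i : ℝ) + 1) * (δ * b ^ i + 2 * δ) ≤ 9 / h * (3 * (δ * b ^ i)) := by
            gcongr
            linarith
        _ = 27 * (1 / b) := by
            rw [hh]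
            field_simp
            ring
        _ ≤ 54 * ρ := by linarith
    refine (measure_biUnion_finset_le _ _).trans ((Finset.sum_le_sum hi).trans (le_of_eq ?_))
    rw [Finset.sum_const, Finset.card_range, nsmul_eq_mul, ← ENNReal.ofReal_natCast,
      ← ENNReal.ofReal_mul (by positivity)]
    congr 1
    ring
  · intro y hy
    obtain ⟨s, hs, hdig⟩ := exists_nat_forall_fract_lt hδ hb1 (fun i => y i + 1) t
    have hs' : δ * (s : ℝ) ≤ 1 := by
      refine le_trans ?_ hδb
      gcongr
      exact_mod_cast hs.le
    have hs0 : 0 ≤ δ * (s : ℝ) := by positivity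
    refine ⟨1 + δ * s, ⟨by linarith, by linarith⟩, fun i hi u hu => ?_⟩
    obtain ⟨m, hm1, hm2⟩ := hdig i hi
    rw [abs_lt] at hu
    have hyi := abs_le.1 (hy i hi)
    refine mem_biUnion (Finset.mem_coe.2 (Finset.mem_range.2 hi))
      (mem_biUnion (x := m) (Finset.mem_coe.2 ?_) ⟨by linarith, by linarith⟩)
    have hh0 : 0 < δ * (b : ℝ) ^ (i + 1) := by positivity
    have hi1 := hle1 i hi.le
    rw [Finset.mem_Icc]
    constructor
    · rw [neg_le]
      refine Int.le_floor.2 ((le_div_iff₀ hh0).2 ?_)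
      push_cast
      linarith
    · refine Int.le_floor.2 ((le_div_iff₀ hh0).2 ?_)
      linarith

end Arithmetic

/-! ### The thin-set example and the exponents in the two regimes. -/

section Sharp

variable {n k : ℕ}

theorem exists_le_skeletonMaximalNorm_of_thin_set (hk : k < n) {p q : ℝ} (hp : 0 < p) (hq : 0 < q) :
    ∃ c : ℝ, 0 < c ∧ ∀ δ : ℝ, 0 < δ → δ < 1 →
      ENNReal.ofReal (c * δ ^ (((k : ℝ) - n) / (2 * n * p))) ≤ skeletonMaximalNorm n k δ p q := by
  classical
  have hn : 0 < n := by omega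
  have hn' : (0 : ℝ) < n := by exact_mod_cast hn
  have hchoose : 0 < n.choose (n - k) := Nat.choose_pos (by omega)
  set V : ℝ := n.choose (n - k) * ((2 * (54 * (2 * n : ℕ))) ^ (n - k) * 10 ^ k) with hV
  have hV0 : 0 < V := by
    have : (0 : ℝ) < (2 * n : ℕ) := by exact_mod_cast (by omega : 0 < 2 * n)
    positivity
  refine ⟨1 / V ^ (1 / p), by positivity, fun δ hδ hδ1 => ?_⟩
  set ρ := δ ^ (1 / (2 * n : ℕ) : ℝ) with hρ
  have hρ0 : 0 < ρ := by positivity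
  have hconv : 1 / V ^ (1 / p) * δ ^ (((k : ℝ) - n) / (2 * n * p)) =
      1 ^ (1 / q) / (V * ρ ^ (n - k)) ^ (1 / p) := by
    rw [Real.mul_rpow hV0.le (by positivity), hρ, ← Real.rpow_natCast (_ ^ _),
      ← Real.rpow_mul hδ.le, ← Real.rpow_mul hδ.le, Real.one_rpow, Nat.cast_sub hk.le,
      show ((k : ℝ) - n) / (2 * n * p) = -(1 / (2 * n : ℕ) * (n - k) * (1 / p)) by
        push_cast
        field_simp
        ring, Real.rpow_neg hδ.le]
    field_simp
  rw [hconv]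
  obtain ⟨D, hDm, hDvol, hD⟩ := exists_thin_set (t := 2 * n) (by omega) hδ hδ1
  rw [← hρ] at hDvol
  set D' := D ∪ -D with hD'
  have hDm' : MeasurableSet D' := hDm.union hDm.neg
  have hDvol' : volume D' ≤ ENNReal.ofReal (2 * (54 * (2 * n : ℕ)) * ρ) := by
    refine (measure_union_le _ _).trans ?_
    rw [Measure.measure_neg, ← two_mul, mul_assoc, ENNReal.ofReal_mul (by norm_num),
      ENNReal.ofReal_ofNat]
    gcongr
  let B : Finset (Fin n) → Set (EuclideanSpace ℝ (Fin n)) := fun J =>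
    {y | ∀ j, y j ∈ if j ∈ J then D' else Icc (-5) 5}
  have hBvol : ∀ J ∈ Finset.powersetCard (n - k) Finset.univ,
      volume (B J) ≤ ENNReal.ofReal ((2 * (54 * (2 * n : ℕ)) * ρ) ^ (n - k) * 10 ^ k) := by
    intro J hJ
    have hJc := (Finset.mem_powersetCard.1 hJ).2
    rw [volume_setOf_forall_mem, ENNReal.ofReal_mul (by positivity),
      ENNReal.ofReal_pow (by positivity), ENNReal.ofReal_pow (by positivity)]
    calc ∏ j, volume (if j ∈ J then D' else Icc (-5 : ℝ) 5)
        ≤ ∏ j, if j ∈ J then ENNReal.ofReal (2 * (54 * (2 * n : ℕ)) * ρ)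
          else ENNReal.ofReal 10 := by
          refine Finset.prod_le_prod' fun j _ => ?_
          split_ifs
          · exact hDvol'
          · rw [Real.volume_Icc]
            norm_num
      _ = _ := by
          rw [Finset.prod_ite, Finset.prod_const, Finset.prod_const, Finset.filter_univ_mem,
            Finset.filter_not, Finset.filter_univ_mem, ← Finset.compl_eq_univ_sdiff,
            Finset.card_compl, Fintype.card_fin, hJc]
          congr 2
          omega
  refine le_skeletonMaximalNorm hk hδ hp hq
    (F := ⋃ J ∈ Finset.powersetCard (n - k) Finset.univ, B J)
    (G := {y | ∀ j, y j ∈ Icc (0 : ℝ) 1}) ?_ ?_ ⟨0, fun j => by simp⟩ ?_ zero_le_one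
    (by positivity) ?_ ?_
  · refine Finset.measurableSet_biUnion _ fun J _ => measurableSet_setOf_forall fun j => ?_
    have : Measurable fun y : EuclideanSpace ℝ (Fin n) => y j := by fun_prop
    split_ifs
    · exact this hDm'
    · exact this measurableSet_Icc
  · refine measurableSet_setOf_forall fun j => ?_
    have : Measurable fun y : EuclideanSpace ℝ (Fin n) => y j := by fun_prop
    exact this measurableSet_Icc
  · intro x hx
    -- The `2n` prescribed numbers are `x_j` and `-x_j`. Fixed face coordinates are `x_j + r ∈ D` or
    -- `x_j - r = -(-x_j + r) ∈ -D`.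
    obtain ⟨r, hr, hrD⟩ := hD (fun i => if h : i < n then x ⟨i, h⟩ else
      if h : i - n < n then - x ⟨i - n, h⟩ else 0) (by
        intro i _
        split_ifs with h h'
        · have := hx ⟨i, h⟩
          rw [abs_le]
          constructor <;> linarith [this.1, this.2]
        · have := hx ⟨i - n, h'⟩
          rw [abs_le]
          constructor <;> linarith [this.1, this.2]
        · simp)
    have hplus : ∀ j : Fin n, ∀ u, |u - (x j + r)| < δ → u ∈ D := by
      intro j u hu
      refine hrD j.1 (by omega) u ?_
      simpa using hu
    have hminus : ∀ j : Fin n, ∀ u, |u - (- x j + r)| < δ → u ∈ D := by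
      intro j u hu
      refine hrD (n + j.1) (by omega) u ?_
      simpa using hu
    refine ⟨r, hr, fun τ y hy => ?_⟩
    have hy' := thickening_face_subset τ x r δ hy
    refine mem_biUnion (x := Finset.univ.filter fun i => τ.1 i ≠ 0) (Finset.mem_coe.2
      (Finset.mem_powersetCard.2 ⟨Finset.subset_univ _, card_filter_ne_zero hk.le τ⟩)) fun j => ?_
    by_cases hj : τ.1 j = 0
    · have h1 := abs_lt.1 ((hy' j).1 hj)
      have h2 := hx j
      simp only [Finset.mem_filter, Finset.mem_univ, hj, ne_eq, not_true, and_false, if_false]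
      constructor <;> linarith [h2.1, h2.2, hr.2]
    · have h1 := (hy' j).2 hj
      simp only [Finset.mem_filter, Finset.mem_univ, hj, ne_eq, not_false_eq_true, and_self,
        if_true]
      rcases SignType.trichotomy (τ.1 j) with h | h | h
      · right
        rw [h] at h1
        refine hminus j _ ?_
        rw [← abs_neg]
        convert h1 using 2
        simp
        ring
      · exact absurd h hj
      · left
        rw [h] at h1
        refine hplus j _ ?_
        simpa using h1
  · rw [volume_setOf_forall_mem]
    simp
  · refine (measure_biUnion_finset_le _ _).trans ((Finset.sum_le_sum hBvol).trans ?_)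
    rw [Finset.sum_const, Finset.card_powersetCard, Finset.card_univ, Fintype.card_fin,
      nsmul_eq_mul, ← ENNReal.ofReal_natCast, ← ENNReal.ofReal_mul (by positivity)]
    refine ENNReal.ofReal_le_ofReal (le_of_eq ?_)
    rw [hV, mul_pow _ ρ]
    ring

theorem qStar_pos (hk : k < n) : 0 < qStar n k := by
  have h1 : (k : ℝ) < n := by exact_mod_cast hk
  have h2 : (1 : ℝ) ≤ n := by exact_mod_cast (by omega : 1 ≤ n)
  have h3 : (0 : ℝ) < n - k := by linarith
  have h4 : (0 : ℝ) < 2 * n - 1 := by linarith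
  unfold qStar
  positivity

theorem exists_skeletonMaximalNorm_le_of_le_qStar (hk : k < n) {p q : ℝ} (hp : 1 < p)
    (hpq : p ≤ q) (hq : q ≤ qStar n k * p) :
    ∃ C : ℝ, 0 < C ∧ ∀ δ : ℝ, 0 < δ → δ < 1 → skeletonMaximalNorm n k δ p q ≤
      ENNReal.ofReal (C * δ ^ (((k : ℝ) - n) / (2 * n * p))) := by
  have hp0 : 0 < p := by linarith
  have hQ := qStar_pos hk
  have hn : 0 < n := by omega
  have hn' : (0 : ℝ) < n := by exact_mod_cast hn
  obtain ⟨A, hA, hle⟩ := exists_skeletonMaximalNorm_le hk hp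
  set s := q / p with hs
  have hs1 : 1 ≤ s := by rwa [hs, le_div_iff₀ hp0, one_mul]
  have hsQ : s ≤ qStar n k := by rwa [hs, div_le_iff₀ hp0]
  have hs0 : 0 < s := by linarith
  set α := 1 / s - 1 / qStar n k with hα
  have hα0 : 0 ≤ α := sub_nonneg.2 (one_div_le_one_div_of_le hs0 hsQ)
  refine ⟨(A * (3 ^ n) ^ α) ^ (1 / p), by positivity, fun δ hδ hδ1 => ?_⟩
  -- Here `N ^ (1 / s) = N ^ α * N ^ (1 / q*)` with `α ≥ 0`. The resulting `δ ^ (-n α)` turns `n /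
  -- s` into `n / q*`, so the final exponent does not depend on `q`.
  have h := hle δ s (((3 / δ) ^ n) ^ α) hδ hδ1 hs1 (by positivity) (by
    intro N hN
    rcases Nat.eq_zero_or_pos N with rfl | hN0
    · rw [Nat.cast_zero, Real.zero_rpow (by positivity)]
      positivity
    · have hN0' : (0 : ℝ) < N := by exact_mod_cast hN0
      rw [show 1 / s = α + 1 / qStar n k by rw [hα]; ring, Real.rpow_add hN0']
      gcongr)
  rw [hs, mul_div_cancel₀ _ hp0.ne', ← hs] at h
  refine h.trans (ENNReal.ofReal_le_ofReal (le_of_eq ?_))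
  have hkey : δ ^ (n / s) * ((3 / δ) ^ n) ^ α / δ ^ (n - k) =
      (3 ^ n) ^ α * δ ^ (((k : ℝ) - n) / (2 * n)) := by
    rw [div_pow, Real.div_rpow (by positivity) (by positivity), ← Real.rpow_natCast δ n,
      ← Real.rpow_natCast δ (n - k), ← Real.rpow_mul hδ.le, Nat.cast_sub hk.le,
      show ((k : ℝ) - n) / (2 * n) = n / s - n * α - (n - k) by
        rw [hα, one_div_qStar hk.le, Nat.cast_sub hk.le]
        field_simp
        ring, Real.rpow_sub hδ (n / s - n * α), Real.rpow_sub hδ (n / s)]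
    ring
  rw [hkey, ← mul_assoc, Real.mul_rpow (by positivity) (by positivity), ← Real.rpow_mul hδ.le]
  congr 2
  field_simp

theorem exists_skeletonMaximalNorm_le_of_qStar_lt (hk : k < n) {p q : ℝ} (hp : 1 < p)
    (hpq : p ≤ q) (hq : qStar n k * p < q) :
    ∃ C : ℝ, 0 < C ∧ ∀ δ : ℝ, 0 < δ → δ < 1 → skeletonMaximalNorm n k δ p q ≤
      ENNReal.ofReal (C * δ ^ ((n : ℝ) / q - ((n : ℝ) - k) / p)) := by
  have hp0 : 0 < p := by linarith
  have hq0 : 0 < q := by linarith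
  have hQ := qStar_pos hk
  obtain ⟨A, hA, hle⟩ := exists_skeletonMaximalNorm_le hk hp
  set s := q / p with hs
  have hs1 : 1 ≤ s := by rwa [hs, le_div_iff₀ hp0, one_mul]
  have hsQ : qStar n k ≤ s := by rw [hs, le_div_iff₀ hp0]; exact hq.le
  have hs0 : 0 < s := by linarith
  refine ⟨A ^ (1 / p), by positivity, fun δ hδ hδ1 => ?_⟩
  -- For `s ≥ q*` the counting loses nothing: a positive integer `N` has `N ^ (1 / s) ≤ N ^ (1 /
  -- q*)`.
  have h := hle δ s 1 hδ hδ1 hs1 zero_le_one (by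
    intro N _
    rw [one_mul]
    rcases Nat.eq_zero_or_pos N with rfl | hN0
    · rw [Nat.cast_zero, Real.zero_rpow (by positivity)]
      positivity
    · exact Real.rpow_le_rpow_of_exponent_le (by exact_mod_cast hN0)
        (one_div_le_one_div_of_le hQ hsQ))
  rw [hs, mul_div_cancel₀ _ hp0.ne', ← hs, mul_one] at h
  refine h.trans (ENNReal.ofReal_le_ofReal (le_of_eq ?_))
  rw [← Real.rpow_natCast δ (n - k), ← Real.rpow_sub hδ,
    Real.mul_rpow (by positivity) (by positivity), ← Real.rpow_mul hδ.le, Nat.cast_sub hk.le]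
  congr 2
  rw [hs]
  field_simp

end Sharp

end SkeletonMax

end

theorem theorem1p2 (n k : ℕ) (hk : k < n) (p q : ℝ) (hp : 1 < p) (hpq : p ≤ q) :
    (q ≤ SkeletonMax.qStar n k * p →
      (∃ C : ℝ, 0 < C ∧ ∀ δ : ℝ, 0 < δ → δ < 1 →
        SkeletonMax.skeletonMaximalNorm n k δ p q ≤
          ENNReal.ofReal (C * δ ^ (((k : ℝ) - n) / (2 * n * p)))) ∧
      (∀ ε : ℝ, 0 < ε → ∃ C' : ℝ, 0 < C' ∧ ∀ δ : ℝ, 0 < δ → δ < 1 →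
        ENNReal.ofReal (C' * δ ^ (((k : ℝ) - n) / (2 * n * p) + ε)) ≤
          SkeletonMax.skeletonMaximalNorm n k δ p q)) ∧
    (SkeletonMax.qStar n k * p < q →
      ∃ c' c : ℝ, 0 < c' ∧ 0 < c ∧ ∀ δ : ℝ, 0 < δ → δ < 1 →
        ENNReal.ofReal (c' * δ ^ ((n : ℝ) / q - ((n : ℝ) - k) / p)) ≤
          SkeletonMax.skeletonMaximalNorm n k δ p q ∧
        SkeletonMax.skeletonMaximalNorm n k δ p q ≤
          ENNReal.ofReal (c * δ ^ ((n : ℝ) / q - ((n : ℝ) - k) / p))) := by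
  have hp0 : 0 < p := by linarith
  have hq0 : 0 < q := by linarith
  refine ⟨fun hq => ⟨SkeletonMax.exists_skeletonMaximalNorm_le_of_le_qStar hk hp hpq hq,
    fun ε hε => ?_⟩, fun hq => ?_⟩
  · obtain ⟨c, hc, h⟩ := SkeletonMax.exists_le_skeletonMaximalNorm_of_thin_set hk hp0 hq0
    -- The lossless bound is stronger: `δ < 1`, so adding `ε` to the exponent only decreases the
    -- power.
    refine ⟨c, hc, fun δ hδ hδ1 => (ENNReal.ofReal_le_ofReal ?_).trans (h δ hδ hδ1)⟩
    exact mul_le_mul_of_nonneg_left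
      (Real.rpow_le_rpow_of_exponent_ge hδ hδ1.le (by linarith)) hc.le
  · obtain ⟨c', hc', h'⟩ := SkeletonMax.exists_le_skeletonMaximalNorm_of_ball hk hp0 hq0
    obtain ⟨c, hc, h⟩ := SkeletonMax.exists_skeletonMaximalNorm_le_of_qStar_lt hk hp hpq hq
    exact ⟨c', c, hc', hc, fun δ hδ hδ1 => ⟨h' δ hδ hδ1, h δ hδ hδ1⟩⟩
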